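/- Let $U\subseteq\mathbb{R}^{d_U}$ and let $X\subseteq\mathbb{R}^{d_X}$ be non-empty, let $A:X\rightrightarrows U$ be a set-valued map with non-empty values, and let $\mathrm{gr}A=\{(u,x):x\in X,\ u\in A(x)\}$. Write $\ell^\infty(T)$ for the bounded functions $T\to\mathbb{R}$ with the uniform norm, $[y]_+=\max\{y,0\}$, and $m$ for Lebesgue measure. For $f,h\in\ell^\infty(\mathrm{gr}A)$, $\epsilon>0$ and $1\le p<\infty$ put $\psi(f)(x)=\sup_{u\in A(x)}f(u,x)$ and $$\lambda_1(f)=\sup_{x\in X}|\psi(f)(x)|,\quad \lambda_2(f)=\sup_{x\in X}[\psi(f)(x)]_+,\quad \lambda_3(f)=\Big(\int_X|\psi(f)|^p\,dm\Big)^{1/p},\quad \lambda_4(f)=\Big(\int_X[\psi(f)]_+^p\,dm\Big)^{1/p},$$ $$U_f(x,\epsilon)=\{u\in A(x):f(u,x)\ge\psi(f)(x)-\epsilon\},\quad U_f(X,\epsilon)=\{(u,x):x\in X,\ u\in U_f(x,\epsilon)\},$$ $$A_f(\epsilon)=\Big\{(u,x)\in\mathrm{gr}A:f(u,x)\ge\sup_{\mathrm{gr}A}f-\epsilon\Big\},\quad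 \psi'_f(h)(x)=\lim_{\epsilon\to0^+}\sup_{u\in U_f(x,\epsilon)}h(u,x),\quad X_0=\{x\in X:\psi(f)(x)=0\}.$$ Let $\mathcal{P}$ be a set of probability laws $P$ of the observations, with associated objective functions $f=f(P)\in\ell^\infty(\mathrm{gr}A)$. Let $\mathcal{P}_{00}^E$ be the set of $P\in\mathcal{P}$ with $\psi(f)\equiv0$, let $\mathcal{P}_0^I$ be the set of $P\in\mathcal{P}$ with $\psi(f)\le0$ everywhere, and let $\mathcal{P}_{00}^I$ be the set of $P\in\mathcal{P}_0^I$ with $\psi(f)(x)=0$ for at least one $x\in X$. Assume that for each $n$ there is a sample $Z_1,\dots,Z_n$ from $P$ and a map $\{Z_i\}_{i=1}^n\mapsto f_n\in\ell^\infty(\mathrm{gr}A)$, and that for some $r_n\to\infty$ one has $r_n(f_n-f)\leadsto\mathcal{G}$, where $\mathcal{G}$ is a tight random element of $\ell^\infty(\mathrm{gr}A)$ and $\leadsto$ is weak convergence in the sense of Hoffmann-J\o rgensen (via outer expectations). For the statements on $\lambda_3$ and $\lambda_4$ assume also that $X$ is Lebesgue measurable with $m(X)<\infty$ and that, for each $n$,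 $\psi(f_n)$ is almost surely a Lebesgue measurable function on $X$. Then: 1. If $P\in\mathcal{P}_{00}^E$, then $$r_n(\lambda_1(f_n)-\lambda_1(f))\leadsto\max\Big\{\lim_{\epsilon\to0^+}\sup_{(u,x)\in U_f(X,\epsilon)}\mathcal{G}(u,x),\ \lim_{\epsilon\to0^+}\sup_{x\in X}\inf_{u\in U_f(x,\epsilon)}(-\mathcal{G}(u,x))\Big\}.$$ 2. (a) If $P\in\mathcal{P}_{00}^I$, then $$r_n(\lambda_2(f_n)-\lambda_2(f))\leadsto\lim_{\epsilon\to0^+}\sup_{(u,x)\in A_f(\epsilon)}[\mathcal{G}(u,x)]_+.$$ (b) If $P\in\mathcal{P}_0^I\setminus\mathcal{P}_{00}^I$ and $\sup_{x\in X}\psi(f)(x)<0$, then $r_n(\lambda_2(f_n)-\lambda_2(f))\to0$ in (outer) probability. If $P\in\mathcal{P}_0^I\setminus\mathcal{P}_{00}^I$ and $\sup_{x\in X}\psi(f)(x)=0$ (a supremum that is not attained), the limit in (a) holds instead. 3. If $P\in\mathcal{P}_{00}^E$, then $$r_n(\lambda_3(f_n)-\lambda_3(f))\leadsto\Big(\int_X|\psi'_f(\mathcal{G})(x)|^p\,dm(x)\Big)^{1/p},$$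 the integrand being almost surely integrable. 4. (a) If $P\in\mathcal{P}_{00}^I$, then $$r_n(\lambda_4(f_n)-\lambda_4(f))\leadsto\Big(\int_{X_0}[\psi'_f(\mathcal{G})(x)]_+^p\,dm(x)\Big)^{1/p},$$ the integrand being almost surely integrable on $X_0$. (b) If $P\in\mathcal{P}_0^I\setminus\mathcal{P}_{00}^I$, then $r_n(\lambda_4(f_n)-\lambda_4(f))\to0$ in (outer) probability. -/

import Mathlib

open Filter Topology MeasureTheory
open scoped BoundedContinuousFunction

noncomputable section

namespace ValueFn

/-! ### Bounded functions, one-sided limits, weak convergence -/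

/-- `ℓ^∞(T)`: the Banach space of bounded functions `T → ℝ` with the uniform norm. -/
abbrev LInf (T : Type*) : Type _ := lp (fun _ : T => ℝ) ⊤

/-- The one-sided limit of `F ε` as `ε → 0⁺`. It exists wherever it is used below: see the lemmas
`tendsto_...`. -/
def limPos (F : ℝ → ℝ) : ℝ := limUnder (𝓝[>] (0 : ℝ)) F

/-- Outer expectation of a bounded, not necessarily measurable, function: the infimum of the
expectations of its measurable (integrable) majorants. -/
def outerExp {Ω : Type*} [MeasurableSpace Ω] (μ : Measure Ω) (T : Ω → ℝ) : ℝ :=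
  sInf {e : ℝ | ∃ V : Ω → ℝ, Measurable V ∧ Integrable V μ ∧ (∀ ω, T ω ≤ V ω) ∧
    e = ∫ ω, V ω ∂μ}

/-- Weak convergence in the sense of Hoffmann-Jørgensen: the limit `Y` is Borel measurable and
`E^* φ(Y_n) → E φ(Y)` for every bounded continuous real `φ`. The `Y_n` are arbitrary maps, each on
its own probability space. -/
def WeakConv {D : Type*} [TopologicalSpace D] {Ω : ℕ → Type*} [∀ n, MeasurableSpace (Ω n)]
    (μ : ∀ n, Measure (Ω n)) (Yn : ∀ n, Ω n → D)
    {Ω' : Type*} [mΩ' : MeasurableSpace Ω'] (ν : Measure Ω') (Y : Ω' → D) : Prop :=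
  Measurable[mΩ', borel D] Y ∧
    ∀ φ : D →ᵇ ℝ, Tendsto (fun n => outerExp (μ n) (fun ω => φ (Yn n ω))) atTop
      (𝓝 (∫ ω, φ (Y ω) ∂ν))

/-- Tightness of a random element: up to `ε` its mass sits on a compact set. -/
def TightElem {D : Type*} [TopologicalSpace D] {Ω' : Type*} [MeasurableSpace Ω']
    (ν : Measure Ω') (Y : Ω' → D) : Prop :=
  ∀ ε : ENNReal, 0 < ε → ∃ K : Set D, IsCompact K ∧ ν {ω | Y ω ∉ K} ≤ ε

/-- Convergence to `0` in (outer) probability of real maps, each on its own probability space. -/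
def ConvProbZero {Ω : ℕ → Type*} [∀ n, MeasurableSpace (Ω n)]
    (μ : ∀ n, Measure (Ω n)) (Yn : ∀ n, Ω n → ℝ) : Prop :=
  ∀ ε : ℝ, 0 < ε → Tendsto (fun n => μ n {ω | ε < |Yn n ω|}) atTop (𝓝 0)

/-! ### Value function and statistics -/

section Model

variable {dU dX : ℕ} {X : Set (EuclideanSpace ℝ (Fin dX))}

/-- Lebesgue measure on a (Lebesgue measurable) set `X ⊆ ℝ^d`. -/
def leb {d : ℕ} (X : Set (EuclideanSpace ℝ (Fin d))) : Measure X :=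
  (volume : Measure (EuclideanSpace ℝ (Fin d))).comap Subtype.val

/-- The graph of the choice correspondence `A : X ⇉ ℝ^{dU}`, as a set of pairs `(u, x)`. -/
def gr (A : X → Set (EuclideanSpace ℝ (Fin dU))) : Set (EuclideanSpace ℝ (Fin dU) × X) :=
  {q | q.1 ∈ A q.2}

variable {A : X → Set (EuclideanSpace ℝ (Fin dU))}

/-- The value `f(u, x)` for `x ∈ X`, `u ∈ A(x)`. -/
def ev (f : LInf (gr A)) (x : X) (u : A x) : ℝ := f ⟨((u : EuclideanSpace ℝ (Fin dU)), x), u.2⟩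

/-- The value function `ψ(f)(x) = sup_{u ∈ A(x)} f(u, x)`. -/
def psi (f : LInf (gr A)) (x : X) : ℝ := ⨆ u : A x, ev f x u

/-- `μ(f) = sup_{gr A} f`. -/
def muSup (f : LInf (gr A)) : ℝ := ⨆ q : gr A, f q

/-- `λ₁(f) = sup_x |ψ(f)(x)|`. -/
def lam1 (f : LInf (gr A)) : ℝ := ⨆ x : X, |psi f x|

/-- `λ₂(f) = sup_x [ψ(f)(x)]₊`. -/
def lam2 (f : LInf (gr A)) : ℝ := ⨆ x : X, max (psi f x) 0

/-- `λ₃(f) = (∫_X |ψ(f)|^p dm)^{1/p}`, `m` Lebesgue measure. -/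
def lam3 (p : ℝ) (f : LInf (gr A)) : ℝ := (∫ x, |psi f x| ^ p ∂leb X) ^ (1 / p)

/-- `λ₄(f) = (∫_X [ψ(f)]₊^p dm)^{1/p}`, `m` Lebesgue measure. -/
def lam4 (p : ℝ) (f : LInf (gr A)) : ℝ := (∫ x, (max (psi f x) 0) ^ p ∂leb X) ^ (1 / p)

/-- `U_f(x, ε)`: the `ε`-maximizers of `f(·, x)` over `A(x)`. -/
def nearMax (f : LInf (gr A)) (x : X) (ε : ℝ) : Set (A x) := {u | psi f x - ε ≤ ev f x u}

/-- `U_f(X, ε)`: the pairs `(u, x)` with `x ∈ X` and `u ∈ U_f(x, ε)`. -/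
def nearMaxGr (f : LInf (gr A)) (ε : ℝ) : Set (gr A) :=
  {q | (⟨q.1.1, q.2⟩ : A q.1.2) ∈ nearMax f q.1.2 ε}

/-- `A_f(ε)`: the `ε`-maximizers of `f` over `gr A`. -/
def globalNearMax (f : LInf (gr A)) (ε : ℝ) : Set (gr A) := {q | muSup f - ε ≤ f q}

/-- The contact set `X₀ = {x : ψ(f)(x) = 0}`. -/
def contact (f : LInf (gr A)) : Set X := {x | psi f x = 0}

/-- `ψ'_f(h)(x) = lim_{ε → 0⁺} sup_{u ∈ U_f(x, ε)} h(u, x)`. -/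
def psiDeriv (f h : LInf (gr A)) (x : X) : ℝ :=
  limPos fun ε => ⨆ u : nearMax f x ε, ev h x u

/-- `max { lim_{ε → 0⁺} sup_{(u,x) ∈ U_f(X,ε)} h(u,x),
  lim_{ε → 0⁺} sup_{x ∈ X} inf_{u ∈ U_f(x,ε)} (-h(u,x)) }`. -/
def limit1 (f h : LInf (gr A)) : ℝ :=
  max (limPos fun ε => ⨆ q : nearMaxGr f ε, h q)
    (limPos fun ε => ⨆ x : X, ⨅ u : nearMax f x ε, -ev h x u)

/-- `lim_{ε → 0⁺} sup_{(u,x) ∈ A_f(ε)} [h(u,x)]₊`. -/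
def limit2 (f h : LInf (gr A)) : ℝ := limPos fun ε => ⨆ q : globalNearMax f ε, max (h q) 0

/-- `(∫_X |ψ'_f(h)|^p dm)^{1/p}`. -/
def limit3 (p : ℝ) (f h : LInf (gr A)) : ℝ := (∫ x, |psiDeriv f h x| ^ p ∂leb X) ^ (1 / p)

/-- `(∫_{X₀} [ψ'_f(h)]₊^p dm)^{1/p}`. -/
def limit4 (p : ℝ) (f h : LInf (gr A)) : ℝ :=
  (∫ x in contact f, (max (psiDeriv f h x) 0) ^ p ∂leb X) ^ (1 / p)

/-! ### Null classes -/

variable {S : Type*} [MeasurableSpace S]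

/-- `𝒫₀₀^E`: laws in the model `𝓜` for which the value function of the objective `f P` vanishes
identically. -/
def P00E (𝓜 : Set (ProbabilityMeasure S)) (f : ProbabilityMeasure S → LInf (gr A)) :
    Set (ProbabilityMeasure S) := {P ∈ 𝓜 | ∀ x : X, psi (f P) x = 0}

/-- `𝒫₀^I`: laws in the model for which the value function is nowhere positive. -/
def P0I (𝓜 : Set (ProbabilityMeasure S)) (f : ProbabilityMeasure S → LInf (gr A)) :
    Set (ProbabilityMeasure S) := {P ∈ 𝓜 | ∀ x : X, psi (f P) x ≤ 0}

/-- `𝒫₀₀^I`: laws in `𝒫₀^I` for which the value function is zero somewhere. -/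
def P00I (𝓜 : Set (ProbabilityMeasure S)) (f : ProbabilityMeasure S → LInf (gr A)) :
    Set (ProbabilityMeasure S) := {P ∈ P0I 𝓜 f | ∃ x : X, psi (f P) x = 0}

/-! ### The one-sided limits exist -/

theorem tendsto_limPos_of_mono {F : ℝ → ℝ} {M : ℝ} (hF : MonotoneOn F (Set.Ioi 0))
    (hM : ∀ ε, 0 < ε → -M ≤ F ε) : Tendsto F (𝓝[>] 0) (𝓝 (limPos F)) := by
  have h := hF.tendsto_nhdsGT (x := (0 : ℝ)) ⟨-M, by rintro _ ⟨ε, hε, rfl⟩; exact hM ε hε⟩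
  exact tendsto_nhds_limUnder ⟨_, h⟩

theorem tendsto_limPos_of_anti {F : ℝ → ℝ} {M : ℝ} (hF : AntitoneOn F (Set.Ioi 0))
    (hM : ∀ ε, 0 < ε → F ε ≤ M) : Tendsto F (𝓝[>] 0) (𝓝 (limPos F)) := by
  have h := hF.tendsto_nhdsGT (x := (0 : ℝ)) ⟨M, by rintro _ ⟨ε, hε, rfl⟩; exact hM ε hε⟩
  exact tendsto_nhds_limUnder ⟨_, h⟩

theorem abs_apply_le {T : Type*} (f : LInf T) (q : T) : |f q| ≤ ‖f‖ :=
  lp.norm_apply_le_norm ENNReal.top_ne_zero f q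

theorem abs_ev_le (f : LInf (gr A)) (x : X) (u : A x) : |ev f x u| ≤ ‖f‖ := abs_apply_le f _

/-- Suprema of a bounded function over an increasing family of non-empty sets converge. -/
theorem tendsto_iSup_mono {T : Type*} {s : ℝ → Set T} (hs : Monotone s)
    (hne : ∀ ε, 0 < ε → (s ε).Nonempty) {k : T → ℝ} {M : ℝ} (hk : ∀ t, |k t| ≤ M) :
    Tendsto (fun ε => ⨆ t : s ε, k t) (𝓝[>] 0) (𝓝 (limPos fun ε => ⨆ t : s ε, k t)) := by
  have hb : ∀ ε, BddAbove (Set.range fun t : s ε => k t) := fun ε =>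
    ⟨M, by rintro _ ⟨t, rfl⟩; exact (abs_le.1 (hk t)).2⟩
  refine tendsto_limPos_of_mono (M := M) ?_ ?_
  · intro a ha b _ hab
    have : Nonempty (s a) := (hne a ha).to_subtype
    exact ciSup_le fun t => le_ciSup (hb b) ⟨t.1, hs hab t.2⟩
  · intro ε hε
    obtain ⟨t, ht⟩ := hne ε hε
    exact (abs_le.1 (hk t)).1.trans (le_ciSup (hb ε) ⟨t, ht⟩)

theorem nearMax_nonempty (hA : ∀ x, (A x).Nonempty) (f : LInf (gr A)) (x : X) {ε : ℝ}
    (hε : 0 < ε) : (nearMax f x ε).Nonempty := by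
  have : Nonempty (A x) := (hA x).to_subtype
  have hlt : psi f x - ε < psi f x := sub_lt_self _ hε
  obtain ⟨u, hu⟩ := exists_lt_of_lt_ciSup (f := fun u : A x => ev f x u) hlt
  exact ⟨u, hu.le⟩

theorem nearMax_mono (f : LInf (gr A)) (x : X) : Monotone (nearMax f x) :=
  fun _ _ hab _ hu => (sub_le_sub_left hab _).trans hu

theorem tendsto_psiDeriv (hA : ∀ x, (A x).Nonempty) (f h : LInf (gr A)) (x : X) :
    Tendsto (fun ε => ⨆ u : nearMax f x ε, ev h x u) (𝓝[>] 0) (𝓝 (psiDeriv f h x)) :=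
  tendsto_iSup_mono (nearMax_mono f x) (fun _ hε => nearMax_nonempty hA f x hε) (abs_ev_le h x)

theorem tendsto_limit1_fst (hX : X.Nonempty) (hA : ∀ x, (A x).Nonempty) (f h : LInf (gr A)) :
    Tendsto (fun ε => ⨆ q : nearMaxGr f ε, h q) (𝓝[>] 0)
      (𝓝 (limPos fun ε => ⨆ q : nearMaxGr f ε, h q)) := by
  have hm : Monotone (nearMaxGr f) := fun a b hab q hq => nearMax_mono f q.1.2 hab hq
  refine tendsto_iSup_mono (s := nearMaxGr f) (k := fun q => h q) hm ?_ (abs_apply_le h)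
  intro ε hε
  obtain ⟨u, hu⟩ := nearMax_nonempty hA f ⟨_, hX.some_mem⟩ hε
  exact ⟨⟨(u.1, ⟨_, hX.some_mem⟩), u.2⟩, hu⟩

theorem tendsto_limit1_snd (hX : X.Nonempty) (hA : ∀ x, (A x).Nonempty) (f h : LInf (gr A)) :
    Tendsto (fun ε => ⨆ x : X, ⨅ u : nearMax f x ε, -ev h x u) (𝓝[>] 0)
      (𝓝 (limPos fun ε => ⨆ x : X, ⨅ u : nearMax f x ε, -ev h x u)) := by
  have : Nonempty X := hX.to_subtype
  have hb : ∀ x ε, BddBelow (Set.range fun u : nearMax f x ε => -ev h x u) := fun x ε =>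
    ⟨-‖h‖, by rintro _ ⟨t, rfl⟩; exact neg_le_neg (abs_le.1 (abs_ev_le h x t)).2⟩
  have hle : ∀ x ε, 0 < ε → ⨅ u : nearMax f x ε, -ev h x u ≤ ‖h‖ := fun x ε hε => by
    obtain ⟨u, hu⟩ := nearMax_nonempty hA f x hε
    exact (ciInf_le (hb x ε) ⟨u, hu⟩).trans (neg_le.1 (abs_le.1 (abs_ev_le h x u)).1)
  refine tendsto_limPos_of_anti (M := ‖h‖) ?_ fun ε hε => ciSup_le fun x => hle x ε hε
  intro a ha b _ hab
  refine ciSup_mono ⟨‖h‖, by rintro _ ⟨x, rfl⟩; exact hle x a ha⟩ fun x => ?_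
  have : Nonempty (nearMax f x a) := (nearMax_nonempty hA f x ha).to_subtype
  exact le_ciInf fun u => ciInf_le (hb x b) ⟨u.1, nearMax_mono f x hab u.2⟩

theorem tendsto_limit2 (hX : X.Nonempty) (hA : ∀ x, (A x).Nonempty) (f h : LInf (gr A)) :
    Tendsto (fun ε => ⨆ q : globalNearMax f ε, max (h q) 0) (𝓝[>] 0) (𝓝 (limit2 f h)) := by
  have : Nonempty (gr A) := ⟨⟨((hA ⟨_, hX.some_mem⟩).some, ⟨_, hX.some_mem⟩),
    (hA ⟨_, hX.some_mem⟩).some_mem⟩⟩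
  have hm : Monotone (globalNearMax f) := fun a b hab q hq => (sub_le_sub_left hab _).trans hq
  refine tendsto_iSup_mono (s := globalNearMax f) (M := ‖h‖) (k := fun q => max (h q) 0) hm ?_ ?_
  · intro ε hε
    have hlt : muSup f - ε < muSup f := sub_lt_self _ hε
    obtain ⟨q, hq⟩ := exists_lt_of_lt_ciSup (f := fun q : gr A => f q) hlt
    exact ⟨q, hq.le⟩
  · intro q
    rw [abs_of_nonneg (le_max_right _ _)]
    exact max_le (abs_le.1 (abs_apply_le h q)).2 (norm_nonneg h)

end Model

end ValueFn

end

/-! Put `H_n = r_n (f_n - f)` and, for each statistic `Λ`, `g_n(h) = r_n (Λ(f + h / r_n) - Λ f)`, so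
that the scaled statistic is `g_n(H_n)`. By the extended continuous mapping theorem
(`weakConv_of_tendsto`) it is enough that `g_n(h_n) → g₀(h)` whenever `h_n → h`, where the `h_n` may
be confined to sets `S n` that carry `H_n` almost surely. Its proof dominates the tail of the `g_n`
by Lipschitz envelopes, which are legitimate test functions for `H_n`.

The derivative of a supremum comes from a sandwich. An `ε`-maximizer of `f` shows that the quotient
of `psi` is at least `psiDeriv` (`psiDeriv_le_diffQuot`). Once `r ε ≥ 2‖h‖`, points that are not
`ε`-maximizers cannot compete, so the quotient is at most the supremum of `h` over the
`ε`-maximizers (`diffQuot_psi_le`). The same estimates, made uniform in `x`, treat `lam1` and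
`lam2`; these are nonexpansive, so convergence in each fixed direction suffices.

For `lam3` and `lam4` the quotients of `psi` converge pointwise in `x`, bounded by the norm of the
direction, and dominated convergence applies on a finite measure space. For an arbitrary direction
the perturbed value function may be non-measurable, so directions are confined to `measDir`. Where
such directions accumulate, `psi f` and `psiDeriv f h` are limits of measurable functions; `G` lies
there almost surely (`ae_neBot_approach`). -/

namespace ValueFn

/-! ### Outer expectations -/

section OuterExpectation

variable {Ω : Type*} [MeasurableSpace Ω] {μ : Measure Ω} [IsProbabilityMeasure μ]

/-- The bound `M` provides a constant majorant; over an empty set of majorants the infimum would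
take the default value `0`. -/
theorem le_outerExp_of_forall {T : Ω → ℝ} {M c : ℝ} (hM : ∀ ω, T ω ≤ M)
    (h : ∀ V : Ω → ℝ, Measurable V → Integrable V μ → (∀ ω, T ω ≤ V ω) → c ≤ ∫ ω, V ω ∂μ) :
    c ≤ outerExp μ T := by
  refine le_csInf ⟨∫ _, M ∂μ, fun _ => M, measurable_const, integrable_const M, hM, rfl⟩ ?_
  rintro _ ⟨V, hV, hVi, hTV, rfl⟩
  exact h V hV hVi hTV

theorem outerExp_le_integral {T V : Ω → ℝ} {M : ℝ} (hM : ∀ ω, -M ≤ T ω) (hV : Measurable V)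
    (hVi : Integrable V μ) (hTV : ∀ ω, T ω ≤ V ω) : outerExp μ T ≤ ∫ ω, V ω ∂μ := by
  refine csInf_le ⟨-M, ?_⟩ ⟨V, hV, hVi, hTV, rfl⟩
  rintro _ ⟨W, -, hWi, hTW, rfl⟩
  calc -M = ∫ _, -M ∂μ := by simp
    _ ≤ ∫ ω, W ω ∂μ := integral_mono (integrable_const _) hWi fun ω => (hM ω).trans (hTW ω)

/-- Outer expectations are monotone for inequalities that hold almost surely. -/
theorem outerExp_mono_ae {R T : Ω → ℝ} {M : ℝ} (hR : ∀ ω, |R ω| ≤ M) (hT : ∀ ω, |T ω| ≤ M)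
    (h : ∀ᵐ ω ∂μ, R ω ≤ T ω) : outerExp μ R ≤ outerExp μ T := by
  classical
  refine le_outerExp_of_forall (fun ω => (abs_le.1 (hT ω)).2) fun V hV hVi hTV => ?_
  -- A majorant of `T` becomes one of `R` after raising it to `M` on a measurable null set
  -- containing the exceptions.
  obtain ⟨N, hN, hNm, hN0⟩ := exists_measurable_superset_of_null (ae_iff.1 h)
  have hae : N.piecewise (fun _ => M) V =ᵐ[μ] V := by
    filter_upwards [measure_eq_zero_iff_ae_notMem.1 hN0] with ω hω
    exact Set.piecewise_eq_of_notMem _ _ _ hω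
  rw [← integral_congr_ae hae]
  refine outerExp_le_integral (fun ω => (abs_le.1 (hR ω)).1)
    (measurable_const.piecewise hNm hV) (hVi.congr hae.symm) fun ω => ?_
  by_cases hω : ω ∈ N
  · rw [Set.piecewise_eq_of_mem _ _ _ hω]
    exact (abs_le.1 (hR ω)).2
  · rw [Set.piecewise_eq_of_notMem _ _ _ hω]
    exact (not_not.1 fun hn => hω (hN hn)).trans (hTV ω)

/-- Inner expectation is at most outer expectation, since `-W ≤ T ≤ V` for majorants `V` of `T` and
`W` of `-T`. This turns upper bounds for `-φ` into lower bounds for `φ`. -/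
theorem neg_outerExp_neg_le {T : Ω → ℝ} {M : ℝ} (hT : ∀ ω, |T ω| ≤ M) :
    -outerExp μ (fun ω => -T ω) ≤ outerExp μ T := by
  refine le_outerExp_of_forall (fun ω => (abs_le.1 (hT ω)).2) fun V _ hVi hTV => ?_
  rw [neg_le]
  refine le_outerExp_of_forall (M := M) (fun ω => neg_le.1 (abs_le.1 (hT ω)).1)
    fun W _ hWi hTW => ?_
  rw [← integral_neg]
  exact integral_mono hVi.neg hWi fun ω => (neg_le_neg (hTV ω)).trans (hTW ω)

/-- Markov's inequality for outer expectations. -/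
theorem measure_one_le_ofReal_outerExp {T : Ω → ℝ} {M : ℝ} (h0 : ∀ ω, 0 ≤ T ω)
    (hT : ∀ ω, T ω ≤ M) : μ {ω | 1 ≤ T ω} ≤ ENNReal.ofReal (outerExp μ T) := by
  have hfin : μ {ω | 1 ≤ T ω} ≠ ⊤ := measure_ne_top _ _
  rw [ENNReal.le_ofReal_iff_toReal_le hfin
    (le_outerExp_of_forall hT fun V _ _ hTV => integral_nonneg fun ω => (h0 ω).trans (hTV ω))]
  refine le_outerExp_of_forall hT fun V _ hVi hTV => ?_
  have hm := mul_meas_ge_le_integral_of_nonneg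
    (Eventually.of_forall fun ω => (h0 ω).trans (hTV ω)) hVi 1
  rw [one_mul] at hm
  exact (measureReal_mono fun ω (hω : 1 ≤ T ω) => hω.trans (hTV ω)).trans hm

end OuterExpectation

/-! ### The extended continuous mapping theorem -/

/-- The least `k`-Lipschitz function above a bounded family of functions. -/
noncomputable def lipEnvelope {ι D : Type*} [PseudoMetricSpace D] (F : ι → D → ℝ) (k : ℝ)
    (h : D) : ℝ :=
  ⨆ q : ι × D, (F q.1 q.2 - k * dist h q.2)

section Envelope

variable {ι D : Type*} [PseudoMetricSpace D] {F : ι → D → ℝ} {M k : ℝ}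

theorem bddAbove_lipEnvelope (hk : 0 ≤ k) (hF : ∀ i h, |F i h| ≤ M) (h : D) :
    BddAbove (Set.range fun q : ι × D => F q.1 q.2 - k * dist h q.2) := by
  refine ⟨M, ?_⟩
  rintro _ ⟨q, rfl⟩
  have := (abs_le.1 (hF q.1 q.2)).2
  have := mul_nonneg hk (dist_nonneg (x := h) (y := q.2))
  dsimp only
  linarith

theorem le_lipEnvelope (hk : 0 ≤ k) (hF : ∀ i h, |F i h| ≤ M) (i : ι) (h : D) :
    F i h ≤ lipEnvelope F k h := by
  refine le_trans (le_of_eq ?_) (le_ciSup (bddAbove_lipEnvelope hk hF h) (i, h))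
  simp

theorem abs_lipEnvelope_le [Nonempty ι] (hk : 0 ≤ k) (hF : ∀ i h, |F i h| ≤ M) (h : D) :
    |lipEnvelope F k h| ≤ M := by
  have : Nonempty D := ⟨h⟩
  obtain ⟨i⟩ := ‹Nonempty ι›
  refine abs_le.2 ⟨(abs_le.1 (hF i h)).1.trans (le_lipEnvelope hk hF i h), ciSup_le fun q => ?_⟩
  have := (abs_le.1 (hF q.1 q.2)).2
  have := mul_nonneg hk (dist_nonneg (x := h) (y := q.2))
  linarith

theorem continuous_lipEnvelope [Nonempty ι] (hk : 0 ≤ k) (hF : ∀ i h, |F i h| ≤ M) :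
    Continuous (lipEnvelope F k) := by
  refine (LipschitzWith.of_le_add_mul (Real.toNNReal k) fun a b => ?_).continuous
  rw [Real.coe_toNNReal _ hk]
  have : Nonempty D := ⟨a⟩
  refine ciSup_le fun q => ?_
  have h1 : F q.1 q.2 - k * dist b q.2 ≤ lipEnvelope F k b :=
    le_ciSup (bddAbove_lipEnvelope hk hF b) q
  have h2 := mul_le_mul_of_nonneg_left (dist_triangle_left b q.2 a) hk
  linarith

end Envelope

/-- The filter of pairs `(n, h')` with `n → ∞`, `h' → h`, and `h' ∈ S n`. -/
def approach {D : Type*} [TopologicalSpace D] (S : ℕ → Set D) (h : D) : Filter (ℕ × D) :=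
  (atTop ×ˢ 𝓝 h) ⊓ 𝓟 {q | q.2 ∈ S q.1}

section MappingTheorem

variable {D : Type*} [PseudoMetricSpace D] {Ω : ℕ → Type*} [∀ n, MeasurableSpace (Ω n)]
  {μ : ∀ n, Measure (Ω n)} [∀ n, IsProbabilityMeasure (μ n)] {H : ∀ n, Ω n → D}
  {Ω' : Type*} [MeasurableSpace Ω'] {ν : Measure Ω'} {G : Ω' → D}

/-- Triviality of `approach S h` is an eventual statement near `h`, hence an open condition on `h`.
-/
theorem isClosed_neBot_approach (S : ℕ → Set D) : IsClosed {h | (approach S h).NeBot} := by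
  rw [← isOpen_compl_iff, isOpen_iff_eventually]
  intro h hh
  have key : ∀ a, a ∈ {h | (approach S h).NeBot}ᶜ ↔
      ∀ᶠ q in atTop ×ˢ 𝓝 a, q ∈ {q : ℕ × D | q.2 ∈ S q.1}ᶜ := fun a => by
    rw [Set.mem_compl_iff, Set.mem_ofPred_eq, not_neBot, approach, inf_principal_eq_bot]
    rfl
  simp only [key] at hh ⊢
  obtain ⟨p, hp, t, ht, hpt⟩ := eventually_prod_iff.1 hh
  filter_upwards [eventually_eventually_nhds.2 ht] with a ha
  exact eventually_prod_iff.2 ⟨p, hp, t, ha, hpt⟩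

/-- The test function `min 1 (|y| / ε)` vanishes at `0` and equals `1` where `|y| ≥ ε`, so Markov's
inequality applies. -/
theorem convProbZero_of_weakConv_zero {T : ∀ n, Ω n → ℝ} (hw : WeakConv μ T ν fun _ => (0 : ℝ)) :
    ConvProbZero μ T := by
  intro ε hε
  let φ : ℝ →ᵇ ℝ := BoundedContinuousFunction.ofNormedAddCommGroup
    (fun y : ℝ => min 1 (|y| / ε)) (by fun_prop) 1 fun y => by
      rw [Real.norm_of_nonneg (by positivity)]
      exact min_le_left _ _
  have hφ : ∀ y, φ y = min 1 (|y| / ε) := fun _ => rfl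
  have h := ENNReal.tendsto_ofReal (hw.2 φ)
  simp only [hφ, abs_zero, zero_div, integral_const] at h
  rw [min_eq_right zero_le_one, smul_zero, ENNReal.ofReal_zero] at h
  refine tendsto_of_tendsto_of_tendsto_of_le_of_le tendsto_const_nhds h (fun _ => zero_le)
    fun n => le_trans (measure_mono fun ω hω => ?_)
      (measure_one_le_ofReal_outerExp (M := 1) (fun ω => by positivity) fun ω => min_le_left _ _)
  exact le_min le_rfl ((one_le_div hε).2 (le_of_lt hω))

variable [IsProbabilityMeasure ν]

theorem eventually_outerExp_lt (hw : WeakConv μ H ν G) {S : ℕ → Set D}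
    (hS : ∀ᶠ n in atTop, ∀ᵐ ω ∂μ n, H n ω ∈ S n) {F : ℕ → D → ℝ} {F₀ : D → ℝ} {M : ℝ}
    (hF : ∀ n h, |F n h| ≤ M) (hF₀ : ∀ h, |F₀ h| ≤ M) (hm : Measurable fun ω => F₀ (G ω))
    (hlim : ∀ h, ∀ η > 0, ∀ᶠ q in approach S h, F q.1 q.2 < F₀ h + η) {η : ℝ} (hη : 0 < η) :
    ∀ᶠ n in atTop, outerExp (μ n) (fun ω => F n (H n ω)) < ∫ ω, F₀ (G ω) ∂ν + η := by
  classical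
  -- Indices below `k` and points outside `S n` get the lower bound `-M`, so that they do not raise
  -- the envelope.
  let E : ℕ → ℕ → D → ℝ := fun k n h => if k ≤ n ∧ h ∈ S n then F n h else -M
  have hE : ∀ k n h, |E k n h| ≤ M := fun k n h => by
    have hM : 0 ≤ M := (abs_nonneg _).trans (hF n h)
    dsimp only [E]
    split_ifs
    · exact hF n h
    · rw [abs_neg, abs_of_nonneg hM]
  let Φ : ℕ → D →ᵇ ℝ := fun k => BoundedContinuousFunction.ofNormedAddCommGroup
    (lipEnvelope (E k) k) (continuous_lipEnvelope k.cast_nonneg (hE k)) M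
    (abs_lipEnvelope_le k.cast_nonneg (hE k))
  have hΦM : ∀ k h, |Φ k h| ≤ M := fun k => abs_lipEnvelope_le k.cast_nonneg (hE k)
  have hΦm : ∀ k, Measurable fun ω => Φ k (G ω) := fun k => by
    let : MeasurableSpace D := borel D
    have : BorelSpace D := ⟨rfl⟩
    exact (Φ k).continuous.measurable.comp hw.1
  have hΦi : ∀ k, Integrable (fun ω => Φ k (G ω)) ν := fun k =>
    Integrable.of_bound (hΦm k).aestronglyMeasurable M (Eventually.of_forall fun ω => hΦM k _)
  -- The maximum with `F₀` is needed where `approach S h` is trivial: there the envelopes may fall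
  -- below `F₀ h`. Only an upper bound is wanted.
  have hpt : ∀ h, Tendsto (fun k => max (Φ k h) (F₀ h)) atTop (𝓝 (F₀ h)) := fun h => by
    have hM : 0 ≤ M := (abs_nonneg _).trans (hF₀ h)
    refine tendsto_order.2 ⟨fun a ha => Eventually.of_forall fun k => ha.trans_le
      (le_max_right _ _), fun a ha => ?_⟩
    have hpos : 0 < (a - F₀ h) / 2 := by linarith
    have hev := hlim h _ hpos
    rw [approach, eventually_inf_principal, eventually_prod_iff] at hev
    obtain ⟨p, hp, t, ht, hpt⟩ := hev
    obtain ⟨N, hN⟩ := eventually_atTop.1 hp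
    obtain ⟨δ, hδ, hball⟩ := Metric.eventually_nhds_iff.1 ht
    -- At distance at least `δ` from `h` the penalty is then at least `2 * M`, which brings any
    -- value down to `-M ≤ F₀ h`.
    obtain ⟨K, hK⟩ := exists_nat_gt (2 * M / δ)
    rw [div_lt_iff₀ hδ] at hK
    filter_upwards [eventually_ge_atTop (max N K)] with k hk
    have : Nonempty D := ⟨h⟩
    refine max_lt (lt_of_le_of_lt ?_ (show F₀ h + (a - F₀ h) / 2 < a by linarith)) ha
    refine ciSup_le fun q => ?_
    have hd := mul_nonneg (k.cast_nonneg (α := ℝ)) (dist_nonneg (x := h) (y := q.2))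
    have hl := (abs_le.1 (hF₀ h)).1
    by_cases hq : k ≤ q.1 ∧ q.2 ∈ S q.1
    · rcases lt_or_ge (dist q.2 h) δ with hlt | hge
      · have := hpt (hN q.1 ((le_max_left _ _).trans (hk.trans hq.1))) (hball hlt) hq.2
        simp only [E, if_pos hq]
        linarith
      · have hu := (abs_le.1 (hE k q.1 q.2)).2
        have hkK : (K : ℝ) ≤ k := by exact_mod_cast (le_max_right _ _).trans hk
        have h1 : (K : ℝ) * δ ≤ k * dist h q.2 := by
          rw [dist_comm]
          exact mul_le_mul hkK hge hδ.le k.cast_nonneg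
        linarith
    · simp only [E, if_neg hq]
      linarith
  have hlimint : Tendsto (fun k => ∫ ω, max (Φ k (G ω)) (F₀ (G ω)) ∂ν) atTop
      (𝓝 (∫ ω, F₀ (G ω) ∂ν)) := by
    refine tendsto_integral_of_dominated_convergence (fun _ => M)
      (fun k => ((hΦm k).max hm).aestronglyMeasurable) (integrable_const M)
      (fun k => Eventually.of_forall fun ω => ?_) (Eventually.of_forall fun ω => hpt _)
    exact abs_max_le_max_abs_abs.trans (max_le (hΦM _ _) (hF₀ _))
  obtain ⟨k, hk⟩ := (hlimint.eventually (eventually_lt_nhds (lt_add_of_pos_right _ hη))).exists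
  have hk' : ∫ ω, Φ k (G ω) ∂ν < ∫ ω, F₀ (G ω) ∂ν + η :=
    lt_of_le_of_lt (integral_mono (hΦi k) (Integrable.of_bound
      ((hΦm k).max hm).aestronglyMeasurable M (Eventually.of_forall fun ω =>
        abs_max_le_max_abs_abs.trans (max_le (hΦM _ _) (hF₀ _)))) fun ω => le_max_left _ _) hk
  filter_upwards [(hw.2 (Φ k)).eventually (eventually_lt_nhds hk'), hS, eventually_ge_atTop k]
    with n hn hSn hkn
  refine lt_of_le_of_lt (outerExp_mono_ae (fun ω => hF n _) (fun ω => hΦM k _) ?_) hn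
  filter_upwards [hSn] with ω hω
  refine le_trans (le_of_eq ?_) (le_lipEnvelope k.cast_nonneg (hE k) n (H n ω))
  simp only [E, if_pos (And.intro hkn hω)]

/-- The extended continuous mapping theorem, for real-valued maps. -/
theorem weakConv_of_tendsto (hw : WeakConv μ H ν G) {S : ℕ → Set D}
    (hS : ∀ᶠ n in atTop, ∀ᵐ ω ∂μ n, H n ω ∈ S n) {g : ℕ → D → ℝ} {g₀ : D → ℝ}
    (hm : Measurable[borel D] g₀) {T : ∀ n, Ω n → ℝ}
    (hT : ∀ᶠ n in atTop, ∀ ω, T n ω = g n (H n ω))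
    (hlim : ∀ h, Tendsto (fun q : ℕ × D => g q.1 q.2) (approach S h) (𝓝 (g₀ h))) :
    WeakConv μ T ν fun ω => g₀ (G ω) := by
  have hmG : Measurable fun ω => g₀ (G ω) := hm.comp hw.1
  refine ⟨BorelSpace.measurable_eq (α := ℝ) ▸ hmG, fun φ => ?_⟩
  have hφ : ∀ y, |φ y| ≤ ‖φ‖ := fun y => φ.norm_coe_le_norm y
  have hφ' : ∀ y, |-φ y| ≤ ‖φ‖ := fun y => (abs_neg _).trans_le (hφ y)
  have hup : ∀ η > 0, ∀ᶠ n in atTop,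
      outerExp (μ n) (fun ω => φ (T n ω)) < ∫ ω, φ (g₀ (G ω)) ∂ν + η := fun η hη => by
    filter_upwards [hT, eventually_outerExp_lt hw hS (F := fun n h => φ (g n h))
      (F₀ := fun h => φ (g₀ h)) (fun _ _ => hφ _) (fun _ => hφ _)
      (φ.continuous.measurable.comp hmG) (fun h η hη => ((φ.continuous.tendsto _).comp
        (hlim h)).eventually (eventually_lt_nhds (lt_add_of_pos_right _ hη))) hη] with n hn h
    simpa only [hn] using h
  -- The lower half is the upper half for `-φ`, combined with inner expectation being at most outer
  -- expectation.
  have hlo : ∀ η > 0, ∀ᶠ n in atTop,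
      ∫ ω, φ (g₀ (G ω)) ∂ν - η < outerExp (μ n) (fun ω => φ (T n ω)) := fun η hη => by
    filter_upwards [hT, eventually_outerExp_lt hw hS (F := fun n h => -φ (g n h))
      (F₀ := fun h => -φ (g₀ h)) (fun _ _ => hφ' _) (fun _ => hφ' _)
      (φ.continuous.measurable.comp hmG).neg (fun h η hη => ((φ.continuous.tendsto _).comp
        (hlim h)).neg.eventually (eventually_lt_nhds (lt_add_of_pos_right _ hη))) hη] with n hn h
    simp only [← hn, integral_neg] at h
    have := neg_outerExp_neg_le (μ := μ n) (T := fun ω => φ (T n ω)) fun ω => hφ _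
    linarith
  refine tendsto_order.2 ⟨fun a ha => ?_, fun a ha => ?_⟩
  · simpa using hlo _ (sub_pos.2 ha)
  · simpa using hup _ (sub_pos.2 ha)

/-- The limit lies almost surely where the sets that carry the approximations accumulate. -/
theorem ae_neBot_approach (hw : WeakConv μ H ν G) {S : ℕ → Set D}
    (hS : ∀ᶠ n in atTop, ∀ᵐ ω ∂μ n, H n ω ∈ S n) : ∀ᵐ ω ∂ν, (approach S (G ω)).NeBot := by
  set C : Set D := {h | (approach S h).NeBot} with hC
  have hCm : MeasurableSet[borel D] C := by
    let : MeasurableSpace D := borel D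
    have : BorelSpace D := ⟨rfl⟩
    exact (isClosed_neBot_approach S).measurableSet
  have hGC : MeasurableSet (G ⁻¹' C) := hw.1 hCm
  have hm : Measurable fun ω => Cᶜ.indicator (fun _ => (-1 : ℝ)) (G ω) :=
    measurable_const.indicator hGC.compl
  have hint : ∫ ω, Cᶜ.indicator (fun _ => (-1 : ℝ)) (G ω) ∂ν = -ν.real (G ⁻¹' C)ᶜ := by
    have : (fun ω => Cᶜ.indicator (fun _ => (-1 : ℝ)) (G ω)) =
        (G ⁻¹' C)ᶜ.indicator fun _ => (-1 : ℝ) := rfl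
    rw [this, integral_indicator_const _ hGC.compl]
    simp
  have h0 : ν.real (G ⁻¹' C)ᶜ ≤ 0 := by
    refine le_of_forall_pos_le_add fun η hη => ?_
    -- Compare `0` with the function that is `-1` off `C`: off `C` the filter is trivial, so the
    -- limit condition is vacuous there and mass of `G` off `C` would make the right side negative.
    obtain ⟨n, hn⟩ := (eventually_outerExp_lt hw hS (F := fun _ _ => 0)
      (F₀ := Cᶜ.indicator fun _ => (-1 : ℝ)) (M := 1) (by simp) (fun h => by
        by_cases hh : h ∈ C <;> simp [hh]) hm (fun h η hη => by
        by_cases hh : h ∈ C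
        · simp [hh, hη]
        · rw [not_neBot.1 hh]
          exact eventually_bot) hη).exists
    rw [hint] at hn
    have : (0 : ℝ) ≤ outerExp (μ n) (fun _ => 0) :=
      le_outerExp_of_forall (M := 0) (fun _ => le_rfl) fun V _ _ hV => integral_nonneg hV
    linarith
  rw [ae_iff]
  exact (measureReal_eq_zero_iff (measure_ne_top _ _)).1 (le_antisymm h0 measureReal_nonneg)

end MappingTheorem

/-! ### Directional derivatives of suprema -/

/-- The index from which the bounds hold may depend on `ε`; only the limits of the bounds as `ε →
0⁺` need to agree. -/
theorem tendsto_of_eventually_between {ι : Type*} {l : Filter ι} {y : ι → ℝ} {lo hi : ℝ → ℝ}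
    {L : ℝ} (hlo : Tendsto lo (𝓝[>] 0) (𝓝 L)) (hhi : Tendsto hi (𝓝[>] 0) (𝓝 L))
    (h : ∀ ε > 0, ∀ᶠ i in l, lo ε ≤ y i ∧ y i ≤ hi ε) : Tendsto y l (𝓝 L) := by
  refine tendsto_order.2 ⟨fun a ha => ?_, fun a ha => ?_⟩
  · obtain ⟨ε, hε, h0⟩ := ((hlo.eventually (eventually_gt_nhds ha)).and
      self_mem_nhdsWithin).exists
    filter_upwards [h ε h0] with i hi using hε.trans_le hi.1
  · obtain ⟨ε, hε, h0⟩ := ((hhi.eventually (eventually_lt_nhds ha)).and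
      self_mem_nhdsWithin).exists
    filter_upwards [h ε h0] with i hi using hi.2.trans_lt hε

/-- A limit of the form `F ε - r ε ≤ c` as `ε → 0⁺`. -/
theorem le_of_tendsto_of_sub_mul_le {F : ℝ → ℝ} {L r c : ℝ} (hF : Tendsto F (𝓝[>] 0) (𝓝 L))
    (h : ∀ ε > 0, F ε - r * ε ≤ c) : L ≤ c := by
  have h1 : Tendsto (fun ε => F ε - r * ε) (𝓝[>] 0) (𝓝 (L - r * 0)) :=
    hF.sub ((tendsto_id.mono_left nhdsWithin_le_nhds).const_mul r)
  rw [mul_zero, sub_zero] at h1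
  exact le_of_tendsto h1 (eventually_mem_nhdsWithin.mono h)

section Lipschitz

variable {D : Type*} [PseudoMetricSpace D] {g : ℕ → D → ℝ} {g₀ : D → ℝ}

/-- Moving the direction from `h` to `h'` costs at most `dist h h'`, so fixed directions suffice. -/
theorem tendsto_prod_nhds_of_lipschitz
    (hg : ∀ᶠ n in atTop, ∀ h h', g n h ≤ g n h' + dist h h')
    (hlim : ∀ h, Tendsto (fun n => g n h) atTop (𝓝 (g₀ h))) (h : D) :
    Tendsto (fun q : ℕ × D => g q.1 q.2) (atTop ×ˢ 𝓝 h) (𝓝 (g₀ h)) := by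
  have h1 : Tendsto (fun q : ℕ × D => g q.1 h) (atTop ×ˢ 𝓝 h) (𝓝 (g₀ h)) :=
    (hlim h).comp tendsto_fst
  have h2 : Tendsto (fun q : ℕ × D => dist q.2 h) (atTop ×ˢ 𝓝 h) (𝓝 0) :=
    tendsto_iff_dist_tendsto_zero.1 tendsto_snd
  refine tendsto_of_tendsto_of_tendsto_of_le_of_le' (by simpa using h1.sub h2)
    (by simpa using h1.add h2) ?_ ?_
  · filter_upwards [tendsto_fst.eventually hg] with q hq
    have := hq h q.2
    rw [dist_comm] at this
    linarith
  · filter_upwards [tendsto_fst.eventually hg] with q hq using hq q.2 h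

theorem continuous_of_tendsto_of_lipschitz
    (hg : ∀ᶠ n in atTop, ∀ h h', g n h ≤ g n h' + dist h h')
    (hlim : ∀ h, Tendsto (fun n => g n h) atTop (𝓝 (g₀ h))) : Continuous g₀ := by
  refine (LipschitzWith.of_le_add fun h h' => ?_).continuous
  exact le_of_tendsto_of_tendsto (hlim h) ((hlim h').add_const _)
    (hg.mono fun n hn => hn h h')

end Lipschitz

/-! ### Difference quotients of the value function -/

section Model

variable {dU dX : ℕ} {X : Set (EuclideanSpace ℝ (Fin dX))}
  {A : X → Set (EuclideanSpace ℝ (Fin dU))}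

theorem add_inv_smul_apply {T : Type*} (f h : LInf T) (r : ℝ) (q : T) :
    (f + r⁻¹ • h) q = f q + r⁻¹ * h q :=
  rfl

theorem ev_add_inv_smul (f h : LInf (gr A)) (r : ℝ) (x : X) (u : A x) :
    ev (f + r⁻¹ • h) x u = ev f x u + r⁻¹ * ev h x u :=
  add_inv_smul_apply f h r _

theorem apply_le_add_norm_sub {T : Type*} (f g : LInf T) (q : T) : f q ≤ g q + ‖f - g‖ := by
  have h := (abs_le.1 (abs_apply_le (f - g) q)).2
  simp only [lp.coeFn_sub, Pi.sub_apply] at h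
  linarith

theorem bddAbove_range_apply {T : Type*} (f : LInf T) : BddAbove (Set.range fun q : T => f q) :=
  ⟨‖f‖, by rintro _ ⟨q, rfl⟩; exact (abs_le.1 (abs_apply_le f q)).2⟩

theorem bddAbove_range_ev (f : LInf (gr A)) (x : X) : BddAbove (Set.range (ev f x)) :=
  ⟨‖f‖, by rintro _ ⟨q, rfl⟩; exact (abs_le.1 (abs_ev_le f x q)).2⟩

theorem ev_le_psi (f : LInf (gr A)) (x : X) (u : A x) : ev f x u ≤ psi f x :=
  le_ciSup (bddAbove_range_ev f x) u

theorem apply_le_psi (f : LInf (gr A)) (q : gr A) : f q ≤ psi f q.1.2 :=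
  ev_le_psi f q.1.2 ⟨q.1.1, q.2⟩

theorem apply_le_muSup (f : LInf (gr A)) (q : gr A) : f q ≤ muSup f :=
  le_ciSup (bddAbove_range_apply f) q

theorem psi_le_muSup (hA : ∀ x, (A x).Nonempty) (f : LInf (gr A)) (x : X) :
    psi f x ≤ muSup f := by
  have : Nonempty (A x) := (hA x).to_subtype
  exact ciSup_le fun u => apply_le_muSup f ⟨(u.1, x), u.2⟩

theorem psi_le_add_norm_sub (hA : ∀ x, (A x).Nonempty) (f g : LInf (gr A)) (x : X) :
    psi f x ≤ psi g x + ‖f - g‖ := by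
  have : Nonempty (A x) := (hA x).to_subtype
  refine ciSup_le fun u => (apply_le_add_norm_sub f g _).trans ?_
  exact add_le_add_left (ev_le_psi g x u) _

theorem abs_psi_sub_le (hA : ∀ x, (A x).Nonempty) (f g : LInf (gr A)) (x : X) :
    |psi f x - psi g x| ≤ ‖f - g‖ := by
  have h1 := psi_le_add_norm_sub hA f g x
  have h2 := psi_le_add_norm_sub hA g f x
  rw [norm_sub_rev] at h2
  exact abs_le.2 ⟨by linarith, by linarith⟩

theorem abs_psi_le (hA : ∀ x, (A x).Nonempty) (f : LInf (gr A)) (x : X) : |psi f x| ≤ ‖f‖ := by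
  have : Nonempty (A x) := (hA x).to_subtype
  have u : A x := Classical.arbitrary _
  exact abs_le.2 ⟨(abs_le.1 (abs_ev_le f x u)).1.trans (ev_le_psi f x u),
    ciSup_le fun u => (abs_le.1 (abs_ev_le f x u)).2⟩

theorem mul_norm_inv_smul {D : Type*} [NormedAddCommGroup D] [NormedSpace ℝ D] {r : ℝ}
    (hr : 0 < r) (h : D) : r * ‖r⁻¹ • h‖ = ‖h‖ := by
  rw [norm_smul, Real.norm_of_nonneg (inv_nonneg.2 hr.le), mul_inv_cancel_left₀ hr.ne']

/-- Difference quotients of a nonexpansive function are nonexpansive in the direction. -/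
theorem diffQuot_le_add_dist {D : Type*} [NormedAddCommGroup D] [NormedSpace ℝ D] {Λ : D → ℝ}
    (hΛ : ∀ f g, Λ f ≤ Λ g + ‖f - g‖) (f : D) {r : ℝ} (hr : 0 < r) (h h' : D) :
    r * (Λ (f + r⁻¹ • h) - Λ f) ≤ r * (Λ (f + r⁻¹ • h') - Λ f) + dist h h' := by
  have h1 := mul_le_mul_of_nonneg_left (hΛ (f + r⁻¹ • h) (f + r⁻¹ • h')) hr.le
  rw [mul_add, add_sub_add_left_eq_sub, ← smul_sub, mul_norm_inv_smul hr, ← dist_eq_norm] at h1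
  linarith

theorem abs_diffQuot_psi_le (hA : ∀ x, (A x).Nonempty) (f h : LInf (gr A)) (x : X) {r : ℝ}
    (hr : 0 < r) : |r * (psi (f + r⁻¹ • h) x - psi f x)| ≤ ‖h‖ := by
  rw [abs_mul, abs_of_pos hr, ← mul_norm_inv_smul hr h]
  refine mul_le_mul_of_nonneg_left ((abs_psi_sub_le hA _ _ x).trans_eq ?_) hr.le
  rw [add_sub_cancel_left]

theorem bddAbove_range_ev_nearMax (f h : LInf (gr A)) (x : X) (ε : ℝ) :
    BddAbove (Set.range fun u : nearMax f x ε => ev h x u) :=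
  ⟨‖h‖, by rintro _ ⟨u, rfl⟩; exact (abs_le.1 (abs_ev_le h x u)).2⟩

/-- At an `ε`-maximizer `u` the quotient gains at most `h(u)`, because `f(u) ≤ psi f x`. Any other
point contributes at most `-r ε + ‖h‖ ≤ -‖h‖`, which no supremum of `h` falls below. -/
theorem diffQuot_psi_le (hA : ∀ x, (A x).Nonempty) (f h : LInf (gr A)) (x : X) {r ε : ℝ}
    (hr : 0 < r) (hε : 0 < ε) (hrε : 2 * ‖h‖ ≤ r * ε) :
    r * (psi (f + r⁻¹ • h) x - psi f x) ≤ ⨆ u : nearMax f x ε, ev h x u := by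
  have : Nonempty (A x) := (hA x).to_subtype
  have hb := bddAbove_range_ev_nearMax f h x ε
  obtain ⟨u₀, hu₀⟩ := nearMax_nonempty hA f x hε
  have h0 : -‖h‖ ≤ ⨆ u : nearMax f x ε, ev h x u :=
    (abs_le.1 (abs_ev_le h x u₀)).1.trans (le_ciSup hb ⟨u₀, hu₀⟩)
  rw [← le_div_iff₀' hr, sub_le_iff_le_add]
  refine ciSup_le fun u => ?_
  rw [ev_add_inv_smul, ← mul_le_mul_iff_right₀ hr, mul_add, mul_add,
    mul_inv_cancel_left₀ hr.ne', mul_div_cancel₀ _ hr.ne']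
  by_cases hu : u ∈ nearMax f x ε
  · have h1 := le_ciSup hb ⟨u, hu⟩
    have h2 := mul_le_mul_of_nonneg_left (ev_le_psi f x u) hr.le
    dsimp only at h1
    linarith
  · have h1 : ev f x u < psi f x - ε := not_le.1 hu
    have h2 := mul_le_mul_of_nonneg_left h1.le hr.le
    have h3 := (abs_le.1 (abs_ev_le h x u)).2
    rw [mul_sub] at h2
    linarith

/-- With `r` fixed, each `ε`-maximizer gives the lower bound `h(u) - r ε`; then `ε → 0⁺`. No
largeness of `r` is needed. -/
theorem psiDeriv_le_diffQuot (hA : ∀ x, (A x).Nonempty) (f h : LInf (gr A)) (x : X) {r : ℝ}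
    (hr : 0 < r) : psiDeriv f h x ≤ r * (psi (f + r⁻¹ • h) x - psi f x) := by
  refine le_of_tendsto_of_sub_mul_le (tendsto_psiDeriv hA f h x) (r := r) fun ε hε => ?_
  have : Nonempty (nearMax f x ε) := (nearMax_nonempty hA f x hε).to_subtype
  rw [sub_le_iff_le_add]
  refine ciSup_le fun u => ?_
  have h1 := mul_le_mul_of_nonneg_left (ev_le_psi (f + r⁻¹ • h) x u) hr.le
  have h2 := mul_le_mul_of_nonneg_left (show psi f x - ε ≤ ev f x u from u.2) hr.le
  rw [ev_add_inv_smul, mul_add, mul_inv_cancel_left₀ hr.ne'] at h1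
  rw [mul_sub] at h2 ⊢
  linarith

theorem eventually_le_mul {r : ℕ → ℝ} (hr : Tendsto r atTop atTop) (K : ℝ) {ε : ℝ}
    (hε : 0 < ε) : ∀ᶠ n in atTop, K ≤ r n * ε :=
  (hr.atTop_mul_const hε).eventually_ge_atTop K

theorem tendsto_diffQuot_psi (hA : ∀ x, (A x).Nonempty) {r : ℕ → ℝ}
    (hr : Tendsto r atTop atTop) (f h : LInf (gr A)) (x : X) :
    Tendsto (fun n => r n * (psi (f + (r n)⁻¹ • h) x - psi f x)) atTop
      (𝓝 (psiDeriv f h x)) := by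
  refine tendsto_of_eventually_between tendsto_const_nhds (tendsto_psiDeriv hA f h x)
    fun ε hε => ?_
  filter_upwards [hr.eventually_gt_atTop 0, eventually_le_mul hr (2 * ‖h‖) hε] with n h0 hn
  exact ⟨psiDeriv_le_diffQuot hA f h x h0, diffQuot_psi_le hA f h x h0 hε hn⟩

theorem eventually_diffQuot_lipschitz {D : Type*} [NormedAddCommGroup D] [NormedSpace ℝ D]
    {Λ : D → ℝ} (hΛ : ∀ f g, Λ f ≤ Λ g + ‖f - g‖) (f : D) {r : ℕ → ℝ}
    (hr : Tendsto r atTop atTop) : ∀ᶠ n in atTop, ∀ h h',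
      r n * (Λ (f + (r n)⁻¹ • h) - Λ f) ≤ r n * (Λ (f + (r n)⁻¹ • h') - Λ f) + dist h h' := by
  filter_upwards [hr.eventually_gt_atTop 0] with n hn using diffQuot_le_add_dist hΛ f hn

theorem tendsto_diffQuot_psi_prod (hA : ∀ x, (A x).Nonempty) {r : ℕ → ℝ}
    (hr : Tendsto r atTop atTop) (f h : LInf (gr A)) (x : X) :
    Tendsto (fun q : ℕ × LInf (gr A) => r q.1 * (psi (f + (r q.1)⁻¹ • q.2) x - psi f x))
      (atTop ×ˢ 𝓝 h) (𝓝 (psiDeriv f h x)) :=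
  tendsto_prod_nhds_of_lipschitz (g := fun n h => r n * (psi (f + (r n)⁻¹ • h) x - psi f x))
    (g₀ := fun h => psiDeriv f h x)
    (eventually_diffQuot_lipschitz (fun f g => psi_le_add_norm_sub hA f g x) f hr)
    (fun h => tendsto_diffQuot_psi hA hr f h x) h

/-- Limits of nonexpansive quotients are nonexpansive; the rate `n` serves as well as any other,
since `psiDeriv` does not involve it. -/
theorem continuous_psiDeriv (hA : ∀ x, (A x).Nonempty) (f : LInf (gr A)) (x : X) :
    Continuous fun h => psiDeriv f h x :=
  continuous_of_tendsto_of_lipschitz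
    (eventually_diffQuot_lipschitz (fun f g => psi_le_add_norm_sub hA f g x) f
      tendsto_natCast_atTop_atTop)
    (fun h => tendsto_diffQuot_psi hA tendsto_natCast_atTop_atTop f h x)

theorem abs_psiDeriv_le (hA : ∀ x, (A x).Nonempty) (f h : LInf (gr A)) (x : X) :
    |psiDeriv f h x| ≤ ‖h‖ := by
  refine le_of_tendsto (tendsto_diffQuot_psi hA tendsto_natCast_atTop_atTop f h x).abs ?_
  filter_upwards [eventually_gt_atTop 0] with n hn
  exact abs_diffQuot_psi_le hA f h x (Nat.cast_pos.2 hn)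

/-! ### The uniform statistics -/

theorem bddAbove_range_abs_psi (hA : ∀ x, (A x).Nonempty) (f : LInf (gr A)) :
    BddAbove (Set.range fun x => |psi f x|) :=
  ⟨‖f‖, by rintro _ ⟨x, rfl⟩; exact abs_psi_le hA f x⟩

theorem bddAbove_range_psi_pos (hA : ∀ x, (A x).Nonempty) (f : LInf (gr A)) :
    BddAbove (Set.range fun x => max (psi f x) 0) :=
  ⟨‖f‖, by
    rintro _ ⟨x, rfl⟩
    exact max_le ((le_abs_self _).trans (abs_psi_le hA f x)) (norm_nonneg f)⟩

theorem lam1_le_add_norm_sub (hX : X.Nonempty) (hA : ∀ x, (A x).Nonempty) (f g : LInf (gr A)) :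
    lam1 f ≤ lam1 g + ‖f - g‖ := by
  have : Nonempty X := hX.to_subtype
  refine ciSup_le fun x => ?_
  have h1 := le_ciSup (bddAbove_range_abs_psi hA g) x
  have h2 := abs_sub_abs_le_abs_sub (psi f x) (psi g x)
  have h3 := abs_psi_sub_le hA f g x
  change |psi g x| ≤ lam1 g at h1
  linarith

theorem lam2_le_add_norm_sub (hX : X.Nonempty) (hA : ∀ x, (A x).Nonempty) (f g : LInf (gr A)) :
    lam2 f ≤ lam2 g + ‖f - g‖ := by
  have : Nonempty X := hX.to_subtype
  refine ciSup_le fun x => ?_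
  have h1 : max (psi g x) 0 ≤ lam2 g := le_ciSup (bddAbove_range_psi_pos hA g) x
  have h3 := psi_le_add_norm_sub hA f g x
  have h4 := norm_nonneg (f - g)
  exact max_le (by linarith [le_max_left (psi g x) 0]) (by linarith [le_max_right (psi g x) 0])

theorem lam1_eq_zero (hX : X.Nonempty) {f : LInf (gr A)} (hf : ∀ x, psi f x = 0) :
    lam1 f = 0 := by
  have : Nonempty X := hX.to_subtype
  simp [lam1, hf]

theorem lam2_eq_zero (hX : X.Nonempty) {f : LInf (gr A)} (hf : ∀ x, psi f x ≤ 0) :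
    lam2 f = 0 := by
  have : Nonempty X := hX.to_subtype
  simp [lam2, hf]

/-- Boundedness plays no role: the real `sInf` is by definition the negated `sSup` of the negated
set. -/
theorem iInf_neg_eq_neg_iSup {ι : Type*} (a : ι → ℝ) : ⨅ i, -a i = -⨆ i, a i := by
  rw [iInf, Real.sInf_def, iSup]
  congr 2
  ext y
  simp [neg_eq_iff_eq_neg]

theorem tendsto_diffQuot_lam1 (hX : X.Nonempty) (hA : ∀ x, (A x).Nonempty) {r : ℕ → ℝ}
    (hr : Tendsto r atTop atTop) {f : LInf (gr A)} (hf : ∀ x, psi f x = 0) (h : LInf (gr A)) :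
    Tendsto (fun n => r n * (lam1 (f + (r n)⁻¹ • h) - lam1 f)) atTop (𝓝 (limit1 f h)) := by
  have : Nonempty X := hX.to_subtype
  have h1 := tendsto_limit1_fst hX hA f h
  have h2 := tendsto_limit1_snd hX hA f h
  have hneg : ∀ x ε, ⨅ u : nearMax f x ε, -ev h x u = -⨆ u : nearMax f x ε, ev h x u :=
    fun x ε => iInf_neg_eq_neg_iSup _
  have hbd : ∀ ε, 0 < ε →
      BddAbove (Set.range fun x : X => ⨅ u : nearMax f x ε, -ev h x u) := fun ε hε => by
    refine ⟨‖h‖, ?_⟩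
    rintro _ ⟨x, rfl⟩
    obtain ⟨u, hu⟩ := nearMax_nonempty hA f x hε
    have := le_ciSup (bddAbove_range_ev_nearMax f h x ε) ⟨u, hu⟩
    dsimp only at this ⊢
    rw [hneg]
    linarith [(abs_le.1 (abs_ev_le h x u)).1]
  -- As `ε` decreases, the first term of the limit decreases and the second increases. Hence the
  -- first enters the lower bound through its limit and the upper bound at `ε`, and the second the
  -- other way round.
  refine tendsto_of_eventually_between (tendsto_const_nhds.max h2) (h1.max tendsto_const_nhds)
    fun ε hε => ?_
  filter_upwards [hr.eventually_gt_atTop 0, eventually_le_mul hr (2 * ‖h‖) hε] with n h0 hn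
  rw [lam1_eq_zero hX hf, sub_zero]
  have hle : ∀ x, |r n * psi (f + (r n)⁻¹ • h) x| ≤ r n * lam1 (f + (r n)⁻¹ • h) := fun x => by
    rw [abs_mul, abs_of_pos h0]
    exact mul_le_mul_of_nonneg_left (le_ciSup (bddAbove_range_abs_psi hA _) x) h0.le
  have hup : ∀ x, r n * psi (f + (r n)⁻¹ • h) x ≤ ⨆ u : nearMax f x ε, ev h x u := fun x => by
    simpa [hf] using diffQuot_psi_le hA f h x h0 hε hn
  have hlo : ∀ x, psiDeriv f h x ≤ r n * psi (f + (r n)⁻¹ • h) x := fun x => by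
    simpa [hf] using psiDeriv_le_diffQuot hA f h x h0
  refine ⟨max_le (le_of_tendsto_of_sub_mul_le h1 (r := r n) fun δ hδ => ?_)
    (ciSup_le fun x => ?_), ?_⟩
  · have : Nonempty (nearMaxGr f δ) := by
      obtain ⟨u, hu⟩ := nearMax_nonempty hA f ⟨_, hX.some_mem⟩ hδ
      exact ⟨⟨⟨(u.1, ⟨_, hX.some_mem⟩), u.2⟩, hu⟩⟩
    rw [sub_le_iff_le_add]
    refine ciSup_le fun q => ?_
    have h3 := mul_le_mul_of_nonneg_left (apply_le_psi (f + (r n)⁻¹ • h) q.1) h0.le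
    have h4 : psi f q.1.1.2 - δ ≤ f q.1 := q.2
    rw [hf] at h4
    have h5 := mul_le_mul_of_nonneg_left h4 h0.le
    rw [add_inv_smul_apply, mul_add, mul_inv_cancel_left₀ h0.ne'] at h3
    have := (le_abs_self _).trans (hle q.1.1.2)
    linarith
  · rw [hneg]
    exact (neg_le_neg (hup x)).trans ((neg_le_abs _).trans (hle x))
  · rw [← le_div_iff₀' h0]
    refine ciSup_le fun x => ?_
    rw [le_div_iff₀' h0, ← abs_of_pos h0, ← abs_mul, abs_of_pos h0]
    refine abs_le'.2 ⟨le_max_of_le_left ((hup x).trans ?_), le_max_of_le_right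
      ((neg_le_neg (hlo x)).trans ?_)⟩
    · have : Nonempty (nearMax f x ε) := (nearMax_nonempty hA f x hε).to_subtype
      have hb : BddAbove (Set.range fun q : nearMaxGr f ε => h q) :=
        ⟨‖h‖, by rintro _ ⟨q, rfl⟩; exact (abs_le.1 (abs_apply_le h q)).2⟩
      exact ciSup_le fun u => le_ciSup hb ⟨⟨(u.1.1, x), u.1.2⟩, u.2⟩
    · refine le_of_tendsto_of_tendsto (tendsto_psiDeriv hA f h x).neg h2 ?_
      filter_upwards [self_mem_nhdsWithin] with δ hδ
      rw [← hneg]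
      exact le_ciSup (hbd δ hδ) x

/-- Outside `globalNearMax f ε` one has `f < -ε`, and `r ε ≥ 2‖h‖` keeps `r f + h` negative or zero,
so only near-maximizers over the whole graph contribute. Whether the supremum is attained does not
matter. -/
theorem tendsto_diffQuot_lam2 (hX : X.Nonempty) (hA : ∀ x, (A x).Nonempty) {r : ℕ → ℝ}
    (hr : Tendsto r atTop atTop) {f : LInf (gr A)} (hf : muSup f = 0) (h : LInf (gr A)) :
    Tendsto (fun n => r n * (lam2 (f + (r n)⁻¹ • h) - lam2 f)) atTop (𝓝 (limit2 f h)) := by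
  have : Nonempty X := hX.to_subtype
  have hlim := tendsto_limit2 hX hA f h
  have hb : ∀ ε, BddAbove (Set.range fun q : globalNearMax f ε => max (h q) 0) := fun ε =>
    ⟨‖h‖, by
      rintro _ ⟨q, rfl⟩
      exact max_le (abs_le.1 (abs_apply_le h q)).2 (norm_nonneg h)⟩
  have hψ : ∀ x, psi f x ≤ 0 := fun x => hf ▸ psi_le_muSup hA f x
  refine tendsto_of_eventually_between tendsto_const_nhds hlim fun ε hε => ?_
  filter_upwards [hr.eventually_gt_atTop 0, eventually_le_mul hr (2 * ‖h‖) hε] with n h0 hn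
  rw [lam2_eq_zero hX hψ, sub_zero]
  have hle : ∀ x, max (psi (f + (r n)⁻¹ • h) x) 0 ≤ lam2 (f + (r n)⁻¹ • h) :=
    le_ciSup (bddAbove_range_psi_pos hA _)
  refine ⟨le_of_tendsto_of_sub_mul_le hlim (r := r n) fun δ hδ => ?_, ?_⟩
  · have h2 : 0 ≤ r n * lam2 (f + (r n)⁻¹ • h) :=
      mul_nonneg h0.le ((le_max_right _ _).trans (hle ⟨_, hX.some_mem⟩))
    rw [sub_le_iff_le_add]
    refine Real.iSup_le (fun q => max_le ?_ (by positivity)) (by positivity)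
    have h3 := mul_le_mul_of_nonneg_left ((apply_le_psi (f + (r n)⁻¹ • h) q.1).trans
      ((le_max_left _ _).trans (hle _))) h0.le
    have h4 : muSup f - δ ≤ f q.1 := q.2
    rw [hf] at h4
    have h5 := mul_le_mul_of_nonneg_left h4 h0.le
    rw [add_inv_smul_apply, mul_add, mul_inv_cancel_left₀ h0.ne'] at h3
    linarith
  · have hc : 0 ≤ ⨆ q : globalNearMax f ε, max (h q) 0 :=
      Real.iSup_nonneg fun q => le_max_right _ _
    rw [← le_div_iff₀' h0]
    refine ciSup_le fun x => max_le ?_ (div_nonneg hc h0.le)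
    have : Nonempty (A x) := (hA x).to_subtype
    refine ciSup_le fun u => ?_
    rw [ev_add_inv_smul, le_div_iff₀' h0, mul_add, mul_inv_cancel_left₀ h0.ne']
    by_cases hu : (⟨(u.1, x), u.2⟩ : gr A) ∈ globalNearMax f ε
    · have h1 := le_ciSup (hb ε) ⟨_, hu⟩
      have h2 := mul_nonpos_of_nonneg_of_nonpos h0.le ((ev_le_psi f x u).trans (hψ x))
      have h3 : ev h x u ≤ max (ev h x u) 0 := le_max_left _ _
      change max (ev h x u) 0 ≤ _ at h1
      linarith
    · have h1 : ev f x u < muSup f - ε := not_le.1 hu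
      rw [hf] at h1
      have h2 := mul_le_mul_of_nonneg_left h1.le h0.le
      have h3 := (abs_le.1 (abs_ev_le h x u)).2
      linarith [norm_nonneg h]

/-- Once `r n` times the gap `-muSup f` reaches `‖h‖`, the perturbed value function is still
nonpositive and the quotient is exactly `0`. -/
theorem tendsto_diffQuot_lam2_zero (hX : X.Nonempty) (hA : ∀ x, (A x).Nonempty) {r : ℕ → ℝ}
    (hr : Tendsto r atTop atTop) {f : LInf (gr A)} (hf : muSup f < 0) (h : LInf (gr A)) :
    Tendsto (fun n => r n * (lam2 (f + (r n)⁻¹ • h) - lam2 f)) atTop (𝓝 0) := by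
  refine tendsto_const_nhds.congr' ?_
  filter_upwards [hr.eventually_gt_atTop 0, eventually_le_mul hr ‖h‖ (neg_pos.2 hf)] with n h0 hn
  have hψ := psi_le_muSup hA f
  rw [lam2_eq_zero hX fun x => (hψ x).trans hf.le, lam2_eq_zero hX fun x => ?_, sub_zero, mul_zero]
  have h1 := (le_abs_self _).trans (abs_diffQuot_psi_le hA f h x h0)
  have h2 := le_of_mul_le_mul_left (h1.trans hn) h0
  linarith [hψ x]

end Model

/-! ### The integral statistics -/

/-- Dominated convergence and measurability of limits are available along countably generated
filters. -/
instance isCountablyGenerated_approach {D : Type*} [PseudoMetricSpace D] (S : ℕ → Set D) (h : D) :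
    (approach S h).IsCountablyGenerated := by
  unfold approach
  infer_instance

theorem approach_le {D : Type*} [TopologicalSpace D] (S : ℕ → Set D) (h : D) :
    approach S h ≤ atTop ×ˢ 𝓝 h :=
  inf_le_left

theorem eventually_approach_mem {D : Type*} [TopologicalSpace D] (S : ℕ → Set D) (h : D) :
    ∀ᶠ q in approach S h, q.2 ∈ S q.1 :=
  mem_inf_of_right (mem_principal_self _)

/-- A limit of measurable functions along a countably generated filter is measurable, when the
functions are measurable only eventually. -/
theorem aemeasurable_of_tendsto_of_eventually {ι α : Type*} [MeasurableSpace α] {m : Measure α}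
    {l : Filter ι} [l.NeBot] [l.IsCountablyGenerated] {W : ι → α → ℝ} {w : α → ℝ}
    (hW : ∀ᶠ i in l, AEMeasurable (W i) m)
    (hlim : ∀ x, Tendsto (fun i => W i x) l (𝓝 (w x))) : AEMeasurable w m := by
  obtain ⟨u, hu⟩ := exists_seq_tendsto l
  obtain ⟨N, hN⟩ := eventually_atTop.1 (hu.eventually hW)
  refine aemeasurable_of_tendsto_metrizable_ae atTop (f := fun n => W (u (n + N)))
    (fun n => hN _ (Nat.le_add_left _ _)) (Eventually.of_forall fun x => ?_)
  exact (hlim x).comp (hu.comp (tendsto_add_atTop_nat N))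

/-- The integral of a function that depends continuously on a parameter is a Borel function of the
parameter, whether or not the function is measurable. -/
theorem measurable_integral_of_continuous {D α : Type*} [PseudoMetricSpace D] [MeasurableSpace α]
    {m : Measure α} [IsFiniteMeasure m] {W : D → α → ℝ} (hW : ∀ x, Continuous fun h => W h x)
    {B : D → ℝ} (hB : Continuous B) (hWB : ∀ h x, |W h x| ≤ B h) :
    Measurable[borel D] fun h => ∫ x, W h x ∂m := by
  classical
  let _ : MeasurableSpace D := borel D
  have _ : BorelSpace D := ⟨rfl⟩
  -- `E` is closed because limits preserve measurability, and on `E` the integral is continuous by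
  -- dominated convergence. Off `E` the Bochner integral has its default value `0`, so the function
  -- is piecewise continuous.
  let E : Set D := {h | AEMeasurable (W h) m}
  have hE : IsClosed E := by
    refine IsSeqClosed.isClosed fun u h hu hlim => ?_
    exact aemeasurable_of_tendsto_of_eventually (l := atTop) (W := fun n => W (u n))
      (Eventually.of_forall hu) fun x => ((hW x).tendsto h).comp hlim
  have hcont : ContinuousOn (fun h => ∫ x, W h x ∂m) E := fun h _ => by
    refine tendsto_integral_filter_of_dominated_convergence (fun _ => B h + 1) ?_ ?_
      (integrable_const _) (Eventually.of_forall fun x => ((hW x).tendsto h).mono_left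
        nhdsWithin_le_nhds)
    · filter_upwards [self_mem_nhdsWithin] with h' hh' using hh'.aestronglyMeasurable
    · filter_upwards [nhdsWithin_le_nhds ((hB.tendsto h).eventually
        (eventually_lt_nhds (lt_add_one _)))] with h' hh'
      exact Eventually.of_forall fun x => (hWB h' x).trans hh'.le
  have heq : (fun h => ∫ x, W h x ∂m) = E.piecewise (fun h => ∫ x, W h x ∂m) fun _ => 0 := by
    ext h
    by_cases hh : h ∈ E
    · rw [Set.piecewise_eq_of_mem _ _ _ hh]
    · rw [Set.piecewise_eq_of_notMem _ _ _ hh]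
      exact integral_non_aestronglyMeasurable fun hn => hh hn.aemeasurable
  rw [heq]
  exact hcont.measurable_piecewise continuousOn_const hE.measurableSet

theorem mul_integral_rpow {α : Type*} [MeasurableSpace α] {m : Measure α} {p c : ℝ} (hp : 0 < p)
    (hc : 0 ≤ c) {w : α → ℝ} (hw : ∀ x, 0 ≤ w x) :
    c * (∫ x, w x ^ p ∂m) ^ (1 / p) = (∫ x, (c * w x) ^ p ∂m) ^ (1 / p) := by
  have h1 : ∀ x, (c * w x) ^ p = c ^ p * w x ^ p := fun x => Real.mul_rpow hc (hw x)
  have h2 : 0 ≤ ∫ x, w x ^ p ∂m := integral_nonneg fun x => Real.rpow_nonneg (hw x) p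
  simp only [h1]
  rw [integral_const_mul, Real.mul_rpow (Real.rpow_nonneg hc p) h2, ← Real.rpow_mul hc,
    mul_one_div_cancel hp.ne', Real.rpow_one]

theorem abs_rpow_le {a b p : ℝ} (ha : 0 ≤ a) (hab : a ≤ b) (hp : 0 ≤ p) : |a ^ p| ≤ b ^ p := by
  rw [abs_of_nonneg (Real.rpow_nonneg ha p)]
  exact Real.rpow_le_rpow ha hab hp

/-- Convergence of `L_p` norms of scaled functions that vanish in the limit. -/
theorem tendsto_mul_integral_rpow {D α : Type*} [NormedAddCommGroup D] [MeasurableSpace α]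
    {m : Measure α} [IsFiniteMeasure m] {p : ℝ} (hp : 0 < p) {r : ℕ → ℝ}
    (hr : Tendsto r atTop atTop) {S : ℕ → Set D} {h : D} {v : ℕ × D → α → ℝ} {w : α → ℝ}
    (hv : ∀ q x, 0 ≤ v q x) (hb : ∀ q, 0 < r q.1 → ∀ x, r q.1 * v q x ≤ ‖q.2‖)
    (hm : ∀ q, q.2 ∈ S q.1 → AEMeasurable (v q) m)
    (hlim : ∀ x, Tendsto (fun q => r q.1 * v q x) (approach S h) (𝓝 (w x))) :
    Tendsto (fun q => r q.1 * (∫ x, v q x ^ p ∂m) ^ (1 / p)) (approach S h)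
      (𝓝 ((∫ x, w x ^ p ∂m) ^ (1 / p))) := by
  have hr0 : ∀ᶠ q in approach S h, 0 < r q.1 :=
    approach_le S h (tendsto_fst.eventually (hr.eventually_gt_atTop 0))
  have hn : ∀ᶠ q in approach S h, ‖q.2‖ < ‖h‖ + 1 :=
    approach_le S h (tendsto_snd.eventually
      ((continuous_norm.tendsto h).eventually (eventually_lt_nhds (lt_add_one _))))
  have hint : Tendsto (fun q => ∫ x, (r q.1 * v q x) ^ p ∂m) (approach S h)
      (𝓝 (∫ x, w x ^ p ∂m)) := by
    refine tendsto_integral_filter_of_dominated_convergence (fun _ => (‖h‖ + 1) ^ p) ?_ ?_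
      (integrable_const _) (Eventually.of_forall fun x =>
        (Real.continuous_rpow_const hp.le).continuousAt.tendsto.comp (hlim x))
    · filter_upwards [eventually_approach_mem S h] with q hq
      exact (((hm q hq).const_mul _).pow_const p).aestronglyMeasurable
    · filter_upwards [hr0, hn] with q hq hqn
      exact Eventually.of_forall fun x => abs_rpow_le (mul_nonneg hq.le (hv q x))
        ((hb q hq x).trans hqn.le) hp.le
  refine ((Real.continuous_rpow_const (one_div_pos.2 hp).le).continuousAt.tendsto.comp hint).congr'
    ?_
  filter_upwards [hr0] with q hq
  exact (mul_integral_rpow hp hq.le (hv q)).symm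

/-! ### Measurable directions and the integral difference quotients -/

section Model

variable {dU dX : ℕ} {X : Set (EuclideanSpace ℝ (Fin dX))}
  {A : X → Set (EuclideanSpace ℝ (Fin dU))}

theorem isFiniteMeasure_leb {d : ℕ} {X : Set (EuclideanSpace ℝ (Fin d))} (hX : volume X < ⊤) :
    IsFiniteMeasure (leb X) := by
  refine ⟨lt_of_le_of_lt ?_ hX⟩
  refine (Measure.comap_apply_le Subtype.val volume nullMeasurableSet_univ).trans_eq ?_
  simp

/-- The directions `h` for which the value function of `f + h / r_n` is measurable. -/
def measDir (f : LInf (gr A)) (r : ℕ → ℝ) (n : ℕ) : Set (LInf (gr A)) :=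
  {h | AEMeasurable (psi (f + (r n)⁻¹ • h)) (leb X)}

theorem tendsto_diffQuot_psi_approach (hA : ∀ x, (A x).Nonempty) {r : ℕ → ℝ}
    (hr : Tendsto r atTop atTop) (f h : LInf (gr A)) (S : ℕ → Set (LInf (gr A))) (x : X) :
    Tendsto (fun q : ℕ × LInf (gr A) => r q.1 * (psi (f + (r q.1)⁻¹ • q.2) x - psi f x))
      (approach S h) (𝓝 (psiDeriv f h x)) :=
  (tendsto_diffQuot_psi_prod hA hr f h x).mono_left (approach_le S h)

theorem tendsto_psi_add_inv_smul (hA : ∀ x, (A x).Nonempty) {r : ℕ → ℝ}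
    (hr : Tendsto r atTop atTop) (f h : LInf (gr A)) (S : ℕ → Set (LInf (gr A))) (x : X) :
    Tendsto (fun q : ℕ × LInf (gr A) => psi (f + (r q.1)⁻¹ • q.2) x) (approach S h)
      (𝓝 (psi f x)) := by
  have hr' : Tendsto (fun q : ℕ × LInf (gr A) => r q.1) (approach S h) atTop :=
    (hr.comp tendsto_fst).mono_left (approach_le S h)
  have h1 := ((tendsto_inv_atTop_zero.comp hr').mul
    (tendsto_diffQuot_psi_approach hA hr f h S x)).add_const (psi f x)
  rw [zero_mul, zero_add] at h1
  refine h1.congr' ?_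
  filter_upwards [hr'.eventually_gt_atTop 0] with q hq
  simp only [Function.comp_apply]
  rw [inv_mul_cancel_left₀ hq.ne', sub_add_cancel]

/-- Measurability of `psi f` is inherited: it is the pointwise limit of perturbed value functions
along the directions in `measDir` that accumulate at `h`. -/
theorem aemeasurable_psi (hA : ∀ x, (A x).Nonempty) {r : ℕ → ℝ}
    (hr : Tendsto r atTop atTop) {f h : LInf (gr A)} [(approach (measDir f r) h).NeBot] :
    AEMeasurable (psi f) (leb X) :=
  aemeasurable_of_tendsto_of_eventually (eventually_approach_mem (measDir f r) h)
    (tendsto_psi_add_inv_smul hA hr f h _)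

theorem aemeasurable_psiDeriv (hA : ∀ x, (A x).Nonempty) {r : ℕ → ℝ}
    (hr : Tendsto r atTop atTop) {f h : LInf (gr A)} [(approach (measDir f r) h).NeBot] :
    AEMeasurable (psiDeriv f h) (leb X) := by
  have hψ : AEMeasurable (psi f) (leb X) := aemeasurable_psi hA hr (h := h)
  refine aemeasurable_of_tendsto_of_eventually
    ((eventually_approach_mem (measDir f r) h).mono fun q hq => ?_)
    (tendsto_diffQuot_psi_approach hA hr f h _)
  exact (AEMeasurable.sub hq hψ).const_mul _

theorem max_psiDeriv_le (hA : ∀ x, (A x).Nonempty) (f h : LInf (gr A)) (x : X) :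
    max (psiDeriv f h x) 0 ≤ ‖h‖ :=
  max_le ((le_abs_self _).trans (abs_psiDeriv_le hA f h x)) (norm_nonneg h)

theorem integrable_abs_psiDeriv_rpow [IsFiniteMeasure (leb X)] (hA : ∀ x, (A x).Nonempty)
    {f h : LInf (gr A)} {p : ℝ} (hp : 0 ≤ p) (hm : AEMeasurable (psiDeriv f h) (leb X)) :
    Integrable (fun x : X => |psiDeriv f h x| ^ p) (leb X) :=
  Integrable.of_bound (hm.abs.pow_const p).aestronglyMeasurable (‖h‖ ^ p)
    (Eventually.of_forall fun x => abs_rpow_le (abs_nonneg _) (abs_psiDeriv_le hA f h x) hp)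

theorem integrable_psiDeriv_pos_rpow [IsFiniteMeasure (leb X)] (hA : ∀ x, (A x).Nonempty)
    {f h : LInf (gr A)} {p : ℝ} (hp : 0 ≤ p) (hm : AEMeasurable (psiDeriv f h) (leb X)) :
    Integrable (fun x : X => (max (psiDeriv f h x) 0) ^ p) (leb X) :=
  Integrable.of_bound ((hm.max aemeasurable_const).pow_const p).aestronglyMeasurable (‖h‖ ^ p)
    (Eventually.of_forall fun x => abs_rpow_le (le_max_right _ _) (max_psiDeriv_le hA f h x) hp)

theorem measurable_limit3 [IsFiniteMeasure (leb X)] (hA : ∀ x, (A x).Nonempty)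
    (f : LInf (gr A)) {p : ℝ} (hp : 0 ≤ p) :
    Measurable[borel (LInf (gr A))] (limit3 p f) := by
  let _ : MeasurableSpace (LInf (gr A)) := borel _
  exact (measurable_integral_of_continuous (B := fun h => ‖h‖ ^ p)
    (fun x => (Real.continuous_rpow_const hp).comp (continuous_psiDeriv hA f x).abs)
    ((Real.continuous_rpow_const hp).comp continuous_norm)
    fun h x => abs_rpow_le (abs_nonneg _) (abs_psiDeriv_le hA f h x) hp).pow_const _

theorem measurable_limit4 [IsFiniteMeasure (leb X)] (hA : ∀ x, (A x).Nonempty)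
    (f : LInf (gr A)) {p : ℝ} (hp : 0 ≤ p) :
    Measurable[borel (LInf (gr A))] (limit4 p f) := by
  let _ : MeasurableSpace (LInf (gr A)) := borel _
  exact (measurable_integral_of_continuous (B := fun h => ‖h‖ ^ p)
    (fun x => (Real.continuous_rpow_const hp).comp
      ((continuous_psiDeriv hA f x).max continuous_const))
    ((Real.continuous_rpow_const hp).comp continuous_norm)
    fun h x => abs_rpow_le (le_max_right _ _) (max_psiDeriv_le hA f h x) hp).pow_const _

theorem lam3_eq_zero {f : LInf (gr A)} {p : ℝ} (hp : 0 < p) (hf : ∀ x, psi f x = 0) :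
    lam3 p f = 0 := by
  simp [lam3, hf, Real.zero_rpow hp.ne', Real.zero_rpow (inv_pos.2 hp).ne']

theorem lam4_eq_zero {f : LInf (gr A)} {p : ℝ} (hp : 0 < p) (hf : ∀ x, psi f x ≤ 0) :
    lam4 p f = 0 := by
  simp [lam4, hf, Real.zero_rpow hp.ne', Real.zero_rpow (inv_pos.2 hp).ne']

theorem tendsto_diffQuot_lam3 [IsFiniteMeasure (leb X)] (hA : ∀ x, (A x).Nonempty) {r : ℕ → ℝ}
    (hr : Tendsto r atTop atTop) {f : LInf (gr A)} {p : ℝ} (hp : 0 < p)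
    (hf : ∀ x, psi f x = 0) (h : LInf (gr A)) :
    Tendsto (fun q : ℕ × LInf (gr A) => r q.1 * (lam3 p (f + (r q.1)⁻¹ • q.2) - lam3 p f))
      (approach (measDir f r) h) (𝓝 (limit3 p f h)) := by
  have hr0 : ∀ᶠ q in approach (measDir f r) h, 0 < r q.1 :=
    approach_le _ h (tendsto_fst.eventually (hr.eventually_gt_atTop 0))
  rw [lam3_eq_zero hp hf]
  simp only [sub_zero]
  refine tendsto_mul_integral_rpow (S := measDir f r) hp hr (fun _ _ => abs_nonneg _)
    (fun q hq x => ?_) (fun q hq => AEMeasurable.abs hq) fun x => ?_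
  · have := abs_diffQuot_psi_le hA f q.2 x hq
    rwa [hf, sub_zero, abs_mul, abs_of_pos hq] at this
  · refine (tendsto_diffQuot_psi_approach hA hr f h _ x).abs.congr' ?_
    filter_upwards [hr0] with q hq
    rw [hf, sub_zero, abs_mul, abs_of_pos hq]

/-- On the contact set the scaled positive part tends to that of `psiDeriv`. Elsewhere `psi f x <
0`, and the perturbed value is eventually negative, so the positive part vanishes. -/
theorem tendsto_diffQuot_lam4 [IsFiniteMeasure (leb X)] (hA : ∀ x, (A x).Nonempty) {r : ℕ → ℝ}
    (hr : Tendsto r atTop atTop) {f : LInf (gr A)} {p : ℝ} (hp : 0 < p)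
    (hf : ∀ x, psi f x ≤ 0) (h : LInf (gr A)) :
    Tendsto (fun q : ℕ × LInf (gr A) => r q.1 * (lam4 p (f + (r q.1)⁻¹ • q.2) - lam4 p f))
      (approach (measDir f r) h) (𝓝 (limit4 p f h)) := by
  classical
  -- Along the trivial filter there is nothing to show; otherwise `psi f` is measurable, hence so is
  -- the contact set, and the integral over it may be written with an indicator.
  rcases (approach (measDir f r) h).eq_or_neBot with hbot | _
  · rw [hbot]
    exact tendsto_bot
  have hr0 : ∀ᶠ q in approach (measDir f r) h, 0 < r q.1 :=
    approach_le _ h (tendsto_fst.eventually (hr.eventually_gt_atTop 0))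
  have hψ : AEMeasurable (psi f) (leb X) := aemeasurable_psi hA hr (h := h)
  have hc : NullMeasurableSet (contact f) (leb X) :=
    hψ.nullMeasurableSet_preimage (measurableSet_singleton 0)
  have hlim4 : limit4 p f h =
      (∫ x, (contact f).indicator (fun x => max (psiDeriv f h x) 0) x ^ p ∂leb X) ^ (1 / p) := by
    rw [limit4, ← integral_indicator₀ hc]
    congr 2
    ext x
    by_cases hx : x ∈ contact f <;> simp [hx, Real.zero_rpow hp.ne']
  rw [hlim4, lam4_eq_zero hp hf]
  simp only [sub_zero]
  refine tendsto_mul_integral_rpow (S := measDir f r) hp hr (fun _ _ => le_max_right _ _)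
    (fun q hq x => ?_) (fun q hq => AEMeasurable.max hq aemeasurable_const) fun x => ?_
  · rw [mul_max_of_nonneg _ _ hq.le, mul_zero]
    refine max_le ?_ (norm_nonneg _)
    have h1 := (le_abs_self _).trans (abs_diffQuot_psi_le hA f q.2 x hq)
    have h2 := mul_nonpos_of_nonneg_of_nonpos hq.le (hf x)
    linarith
  · by_cases hx : x ∈ contact f
    · rw [Set.indicator_of_mem hx]
      refine ((tendsto_diffQuot_psi_approach hA hr f h _ x).max
        (tendsto_const_nhds (x := (0 : ℝ)))).congr' ?_
      filter_upwards [hr0] with q hq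
      rw [show psi f x = 0 from hx, sub_zero, mul_max_of_nonneg _ _ hq.le, mul_zero]
    · rw [Set.indicator_of_notMem hx]
      refine tendsto_const_nhds.congr' ?_
      filter_upwards [(tendsto_psi_add_inv_smul hA hr f h (measDir f r) x).eventually
        (eventually_lt_nhds (lt_of_le_of_ne (hf x) hx))] with q hq
      rw [max_eq_right hq.le, mul_zero]

end Model

/-! ### The delta method for the estimators -/

section Weak

variable {dU dX : ℕ} {X : Set (EuclideanSpace ℝ (Fin dX))}
  {A : X → Set (EuclideanSpace ℝ (Fin dU))} {Ω : ℕ → Type*} [∀ n, MeasurableSpace (Ω n)]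
  {μ : ∀ n, Measure (Ω n)} {fn : ∀ n, Ω n → LInf (gr A)}
  {Ω' : Type*} [MeasurableSpace Ω'] {ν : Measure Ω'} [IsProbabilityMeasure ν]
  {G : Ω' → LInf (gr A)} {f : LInf (gr A)} {r : ℕ → ℝ}

theorem add_inv_smul_smul_sub {D : Type*} [AddCommGroup D] [Module ℝ D] {c : ℝ} (hc : c ≠ 0)
    (f g : D) : f + c⁻¹ • c • (g - f) = g := by
  rw [inv_smul_smul₀ hc, add_sub_cancel]

theorem eventually_ae_mem_measDir (hr : Tendsto r atTop atTop)
    (h : ∀ n, ∀ᵐ ω ∂μ n, AEMeasurable (psi (fn n ω)) (leb X)) :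
    ∀ᶠ n in atTop, ∀ᵐ ω ∂μ n, r n • (fn n ω - f) ∈ measDir f r n := by
  filter_upwards [hr.eventually_ne_atTop 0] with n hn
  filter_upwards [h n] with ω hω
  simpa only [measDir, Set.mem_ofPred_eq, add_inv_smul_smul_sub hn] using hω

variable [∀ n, IsProbabilityMeasure (μ n)]

/-- The delta method, with directions restricted to sets that carry the approximations. -/
theorem weakConv_diffQuot (hr : Tendsto r atTop atTop)
    (hw : WeakConv μ (fun n ω => r n • (fn n ω - f)) ν G) {S : ℕ → Set (LInf (gr A))}
    (hS : ∀ᶠ n in atTop, ∀ᵐ ω ∂μ n, r n • (fn n ω - f) ∈ S n) {Λ : LInf (gr A) → ℝ}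
    {g₀ : LInf (gr A) → ℝ} (hm : Measurable[borel _] g₀)
    (hlim : ∀ h, Tendsto (fun q : ℕ × LInf (gr A) => r q.1 * (Λ (f + (r q.1)⁻¹ • q.2) - Λ f))
      (approach S h) (𝓝 (g₀ h))) :
    WeakConv μ (fun n ω => r n * (Λ (fn n ω) - Λ f)) ν fun ω => g₀ (G ω) := by
  refine weakConv_of_tendsto hw hS hm
    (g := fun n h => r n * (Λ (f + (r n)⁻¹ • h) - Λ f)) ?_ hlim
  filter_upwards [hr.eventually_ne_atTop 0] with n hn ω
  rw [add_inv_smul_smul_sub hn]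

theorem weakConv_diffQuot_of_lipschitz (hr : Tendsto r atTop atTop)
    (hw : WeakConv μ (fun n ω => r n • (fn n ω - f)) ν G) {Λ : LInf (gr A) → ℝ}
    (hΛ : ∀ f g, Λ f ≤ Λ g + ‖f - g‖) {g₀ : LInf (gr A) → ℝ}
    (hlim : ∀ h, Tendsto (fun n => r n * (Λ (f + (r n)⁻¹ • h) - Λ f)) atTop (𝓝 (g₀ h))) :
    WeakConv μ (fun n ω => r n * (Λ (fn n ω) - Λ f)) ν fun ω => g₀ (G ω) := by
  have hlip := eventually_diffQuot_lipschitz hΛ f hr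
  refine weakConv_diffQuot hr hw (S := fun _ => Set.univ) (by simp) ?_ fun h =>
    (tendsto_prod_nhds_of_lipschitz hlip hlim h).mono_left (approach_le _ h)
  let _ : MeasurableSpace (LInf (gr A)) := borel _
  have _ : BorelSpace (LInf (gr A)) := ⟨rfl⟩
  exact (continuous_of_tendsto_of_lipschitz hlip hlim).measurable

theorem ae_aemeasurable_psiDeriv (hA : ∀ x, (A x).Nonempty) (hr : Tendsto r atTop atTop)
    (hw : WeakConv μ (fun n ω => r n • (fn n ω - f)) ν G)
    (h : ∀ n, ∀ᵐ ω ∂μ n, AEMeasurable (psi (fn n ω)) (leb X)) :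
    ∀ᵐ ω ∂ν, AEMeasurable (psiDeriv f (G ω)) (leb X) := by
  filter_upwards [ae_neBot_approach hw (eventually_ae_mem_measDir hr h)] with ω hω
  exact aemeasurable_psiDeriv hA hr

theorem muSup_eq_zero (hA : ∀ x, (A x).Nonempty) (h0 : ∀ x, psi f x ≤ 0)
    (h : ∃ x, psi f x = 0) : muSup f = 0 := by
  obtain ⟨x, hx⟩ := h
  exact le_antisymm (Real.iSup_le (fun q => (apply_le_psi f q).trans (h0 _)) le_rfl)
    (hx ▸ psi_le_muSup hA f x)

theorem limit4_eq_zero {p : ℝ} (hp : 0 < p) (hf : ∀ x, psi f x ≠ 0) (h : LInf (gr A)) :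
    limit4 p f h = 0 := by
  have : contact f = ∅ := Set.eq_empty_of_forall_notMem hf
  simp [limit4, this, Real.zero_rpow (inv_pos.2 hp).ne']

end Weak

end ValueFn

theorem corollary1
    -- the model: `U`, `X`, a non-empty-valued choice correspondence `A : X ⇉ U`
    {dU dX : ℕ} (U : Set (EuclideanSpace ℝ (Fin dU))) (X : Set (EuclideanSpace ℝ (Fin dX)))
    (hX : X.Nonempty) (A : X → Set (EuclideanSpace ℝ (Fin dU)))
    (hAU : ∀ x, A x ⊆ U) (hA : ∀ x, (A x).Nonempty)
    -- the statistical model: joint laws `P` of the observations and the objective `f P`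
    {𝒵 : Type*} [MeasurableSpace 𝒵] (𝓜 : Set (ProbabilityMeasure (ℕ → 𝒵)))
    (f : ProbabilityMeasure (ℕ → 𝒵) → ValueFn.LInf (ValueFn.gr A))
    (P : ProbabilityMeasure (ℕ → 𝒵))
    -- for each `n`, a sample of size `n` from `P`, and an estimator that is a map of the sample
    {Ω : ℕ → Type*} [∀ n, MeasurableSpace (Ω n)] (Pr : ∀ n, Measure (Ω n))
    [∀ n, IsProbabilityMeasure (Pr n)] (Z : ∀ n, Ω n → Fin n → 𝒵)
    (hZ : ∀ n, Measurable (Z n))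
    (hZP : ∀ n, (Pr n).map (Z n) =
      (P : Measure (ℕ → 𝒵)).map (fun (z : ℕ → 𝒵) (i : Fin n) => z i))
    (est : ∀ n, (Fin n → 𝒵) → ValueFn.LInf (ValueFn.gr A))
    -- `r_n → ∞` and `r_n (f_n - f) ⇝ G`, a tight random element
    (r : ℕ → ℝ) (hr : Tendsto r atTop atTop)
    {Ω' : Type*} [MeasurableSpace Ω'] (Q : Measure Ω') [IsProbabilityMeasure Q]
    (G : Ω' → ValueFn.LInf (ValueFn.gr A)) (hGtight : ValueFn.TightElem Q G)
    (hweak : ValueFn.WeakConv Pr (fun n ω => r n • (est n (Z n ω) - f P)) Q G) :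
    -- (1)
    (P ∈ ValueFn.P00E 𝓜 f →
      ValueFn.WeakConv Pr
        (fun n ω => r n * (ValueFn.lam1 (est n (Z n ω)) - ValueFn.lam1 (f P)))
        Q (fun ω => ValueFn.limit1 (f P) (G ω))) ∧
    -- (2a)
    (P ∈ ValueFn.P00I 𝓜 f →
      ValueFn.WeakConv Pr
        (fun n ω => r n * (ValueFn.lam2 (est n (Z n ω)) - ValueFn.lam2 (f P)))
        Q (fun ω => ValueFn.limit2 (f P) (G ω))) ∧
    -- (2b), when the supremum of the value function is negative
    (P ∈ ValueFn.P0I 𝓜 f \ ValueFn.P00I 𝓜 f → ValueFn.muSup (f P) < 0 →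
      ValueFn.ConvProbZero Pr
        (fun n ω => r n * (ValueFn.lam2 (est n (Z n ω)) - ValueFn.lam2 (f P)))) ∧
    -- (2b'), when the supremum of the value function is zero, but is not attained
    (P ∈ ValueFn.P0I 𝓜 f \ ValueFn.P00I 𝓜 f → ValueFn.muSup (f P) = 0 →
      ValueFn.WeakConv Pr
        (fun n ω => r n * (ValueFn.lam2 (est n (Z n ω)) - ValueFn.lam2 (f P)))
        Q (fun ω => ValueFn.limit2 (f P) (G ω))) ∧
    -- the `L_p` statistics, when `X` is Lebesgue measurable with `m(X) < ∞` and the estimated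
    -- value functions are measurable
    (∀ p : ℝ, 1 ≤ p → NullMeasurableSet X volume → volume X < ⊤ →
      (∀ n, ∀ᵐ ω ∂(Pr n), AEMeasurable (ValueFn.psi (est n (Z n ω))) (ValueFn.leb X)) →
      -- (3)
      (P ∈ ValueFn.P00E 𝓜 f →
        (∀ᵐ ω ∂Q, Integrable (fun x : X => |ValueFn.psiDeriv (f P) (G ω) x| ^ p) (ValueFn.leb X)) ∧
        ValueFn.WeakConv Pr
          (fun n ω => r n * (ValueFn.lam3 p (est n (Z n ω)) - ValueFn.lam3 p (f P)))
          Q (fun ω => ValueFn.limit3 p (f P) (G ω))) ∧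
      -- (4a)
      (P ∈ ValueFn.P00I 𝓜 f →
        (∀ᵐ ω ∂Q, IntegrableOn (fun x : X => (max (ValueFn.psiDeriv (f P) (G ω) x) 0) ^ p)
          (ValueFn.contact (f P)) (ValueFn.leb X)) ∧
        ValueFn.WeakConv Pr
          (fun n ω => r n * (ValueFn.lam4 p (est n (Z n ω)) - ValueFn.lam4 p (f P)))
          Q (fun ω => ValueFn.limit4 p (f P) (G ω))) ∧
      -- (4b)
      (P ∈ ValueFn.P0I 𝓜 f \ ValueFn.P00I 𝓜 f →
        ValueFn.ConvProbZero Pr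
          (fun n ω => r n * (ValueFn.lam4 p (est n (Z n ω)) - ValueFn.lam4 p (f P))))) := by
  have hmem : P ∈ ValueFn.P0I 𝓜 f \ ValueFn.P00I 𝓜 f →
      (∀ x, ValueFn.psi (f P) x ≤ 0) ∧ ∀ x, ValueFn.psi (f P) x ≠ 0 := fun h =>
    ⟨h.1.2, fun x hx => h.2 ⟨h.1, x, hx⟩⟩
  have hlam1 := ValueFn.lam1_le_add_norm_sub hX hA
  have hlam2 := ValueFn.lam2_le_add_norm_sub hX hA
  refine ⟨fun h => ?_, fun h => ?_, fun h hneg => ?_, fun h h0 => ?_, fun p hp _ hfin hmeas => ?_⟩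
  · exact ValueFn.weakConv_diffQuot_of_lipschitz hr hweak hlam1
      (ValueFn.tendsto_diffQuot_lam1 hX hA hr h.2)
  · exact ValueFn.weakConv_diffQuot_of_lipschitz hr hweak hlam2
      (ValueFn.tendsto_diffQuot_lam2 hX hA hr (ValueFn.muSup_eq_zero hA h.1.2 h.2))
  · exact ValueFn.convProbZero_of_weakConv_zero (ValueFn.weakConv_diffQuot_of_lipschitz hr hweak
      hlam2 (ValueFn.tendsto_diffQuot_lam2_zero hX hA hr hneg))
  · exact ValueFn.weakConv_diffQuot_of_lipschitz hr hweak hlam2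
      (ValueFn.tendsto_diffQuot_lam2 hX hA hr h0)
  have : IsFiniteMeasure (ValueFn.leb X) := ValueFn.isFiniteMeasure_leb hfin
  have hp0 : 0 < p := zero_lt_one.trans_le hp
  have hdir := ValueFn.eventually_ae_mem_measDir (f := f P) hr hmeas
  have hderiv := ValueFn.ae_aemeasurable_psiDeriv hA hr hweak hmeas
  -- Nonpositivity of the value function is enough here, whether or not the contact set is empty.
  have h4 : (∀ x, ValueFn.psi (f P) x ≤ 0) → ValueFn.WeakConv Pr
      (fun n ω => r n * (ValueFn.lam4 p (est n (Z n ω)) - ValueFn.lam4 p (f P)))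
      Q (fun ω => ValueFn.limit4 p (f P) (G ω)) := fun h =>
    ValueFn.weakConv_diffQuot hr hweak hdir (ValueFn.measurable_limit4 hA (f P) hp0.le)
      (ValueFn.tendsto_diffQuot_lam4 hA hr hp0 h)
  refine ⟨fun h => ⟨hderiv.mono fun ω => ValueFn.integrable_abs_psiDeriv_rpow hA hp0.le, ?_⟩,
    fun h => ⟨hderiv.mono fun ω hω =>
      (ValueFn.integrable_psiDeriv_pos_rpow hA hp0.le hω).integrableOn, h4 h.1.2⟩, fun h => ?_⟩
  · exact ValueFn.weakConv_diffQuot hr hweak hdir (ValueFn.measurable_limit3 hA (f P) hp0.le)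
      (ValueFn.tendsto_diffQuot_lam3 hA hr hp0 h.2)
  -- The contact set is empty, so the weak limit is the constant `0`, which gives convergence in
  -- probability.
  · have hw := h4 (hmem h).1
    simp only [ValueFn.limit4_eq_zero hp0 (hmem h).2] at hw
    exact ValueFn.convProbZero_of_weakConv_zero hw
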